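/- Let $d$ be a dimension, $|\cdot|$ a norm on $\mathbb{R}^d$, $R>0$, $0\le\alpha<1$, and let $P=(p(i,j))_{i,j\in\mathbb{Z}^d}$ be a space-homogeneous, symmetric, finite-range stochastic matrix: $p(i,j)\ge 0$, $\sum_j p(i,j)=1$, $p(i,i+j)=p(0,j)$, $p(i,j)=p(j,i)$, and $p(0,j)=0$ if $|j|\ge R$. Put $$\mathbf{X}=\Big\{\mathbf{x}\in\mathbb{R}^{\mathbb{Z}^d}:\ \sum_{j\in\mathbb{Z}^d}|\mathbf{x}(j)|\,\alpha^{|j|/R}<\infty\Big\}\qquad(0^0=1),$$ with the $\sigma$-algebra generated by the coordinates. Let $\mathbf{d}\in\mathbf{X}$ (the data). For $k\in\mathbb{Z}^d$, $\mathbf{x}\in\mathbb{R}^{\mathbb{Z}^d}$ and $g\in\mathbb{R}$ let $\mathbf{x}^{k,g}$ be the configuration which has height $\alpha\sum_i p(k,i)\mathbf{x}(i)+(1-\alpha)\mathbf{d}(k)+g$ at $k$ and agrees with $\mathbf{x}$ at all other sites. For a bounded continuous function $f$ on $\mathbb{R}^{\mathbb{Z}^d}$ which depends on finitely many coordinates,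 let $$Lf(\mathbf{x})=\sum_{k\in\mathbb{Z}^d}\int_{\mathbb{R}}\big[f(\mathbf{x}^{k,g})-f(\mathbf{x})\big]\,\frac{e^{-g^2/2}}{\sqrt{2\pi}}\,dg .$$ Then there is a Markov process on $\mathbf{X}$ with generator $L$. That is, there are Markov kernels $S(t)$, $t\ge 0$, on $\mathbf{X}$ with $S(0)=\mathrm{id}$ and $S(s+t)=S(s)S(t)$ such that, for every such $f$ and every $\mathbf{x}\in\mathbf{X}$, $$\lim_{u\downarrow 0}\frac1u\Big(\int f\,dS(u)(\mathbf{x},\cdot)-f(\mathbf{x})\Big)=Lf(\mathbf{x}),$$ and for every probability measure $\nu$ on $\mathbf{X}$ there is a process $(\eta_t)_{t\ge 0}$ with values in $\mathbf{X}$, with initial law $\nu$, which is Markov with transition kernels $S(t)$ with respect to $\mathcal{F}_t=\sigma(\eta_s,\ s\le t)$, and which satisfies, for every such $f$ and every $t\ge 0$, $$\lim_{u\downarrow 0}\frac1u\,\mathsf{E}\big[f(\eta_{t+u})-f(\eta_t)\,\big|\,\mathcal{F}_t\big]=Lf(\eta_t),$$ where the limit holds almost surely along every sequence $u_n\downarrow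 0$ (i.e. $u_n>0$, $u_n\to 0$). -/

import Mathlib

open MeasureTheory ProbabilityTheory Filter Topology
open scoped NNReal

namespace Harness

/-- Sites of the lattice `ℤ^d`. -/
abbrev Site (d : ℕ) := Fin d → ℤ

/-- Height configurations, with the product topology and the product σ-algebra. -/
abbrev Config (d : ℕ) := Site d → ℝ

/-- The length `|j|` of a site `j`, for a (semi)norm `N` on `ℝ^d`. -/
def siteNorm {d : ℕ} (N : Seminorm ℝ (Fin d → ℝ)) (j : Site d) : ℝ :=
  N (fun a => (j a : ℝ))

/-- `p` is a space homogeneous, symmetric, stochastic matrix on `ℤ^d` of range `R`. -/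
structure IsHarnessMatrix {d : ℕ} (N : Seminorm ℝ (Fin d → ℝ)) (R : ℝ)
    (p : Site d → Site d → ℝ) : Prop where
  nonneg : ∀ i j, 0 ≤ p i j
  hasSum_one : ∀ i, HasSum (p i) 1
  homogeneous : ∀ i j, p i (i + j) = p 0 j
  finite_range : ∀ j, R ≤ siteNorm N j → p 0 j = 0
  symmetric : ∀ i j, p i j = p j i

/-- The growth class `X`: configurations with `∑_j |x(j)| α^{|j|/R} < ∞`. -/
def growthClass {d : ℕ} (N : Seminorm ℝ (Fin d → ℝ)) (R α : ℝ) : Set (Config d) :=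
  {x | Summable fun j : Site d => |x j| * α ^ (siteNorm N j / R)}

/-- The configuration after an update at site `k` with noise value `g`: the height at `k` becomes
`α ∑_i p(k,i) x(i) + (1 - α) D(k) + g`, all other heights are unchanged. -/
noncomputable def heatBath {d : ℕ} (p : Site d → Site d → ℝ) (α : ℝ) (D : Config d)
    (k : Site d) (x : Config d) (g : ℝ) : Config d :=
  Function.update x k (α * (∑' i, p k i * x i) + (1 - α) * D k + g)

/-- The one-site generator `L_k`, with standard Gaussian noise. -/
noncomputable def siteGenerator {d : ℕ} (p : Site d → Site d → ℝ) (α : ℝ) (D : Config d)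
    (k : Site d) (f : Config d → ℝ) (x : Config d) : ℝ :=
  ∫ g, (f (heatBath p α D k x g) - f x) ∂(gaussianReal 0 1)

/-- The generator `L = ∑_k L_k`. On functions of finitely many coordinates only finitely many
terms of the sum are nonzero. -/
noncomputable def generator {d : ℕ} (p : Site d → Site d → ℝ) (α : ℝ) (D : Config d)
    (f : Config d → ℝ) (x : Config d) : ℝ :=
  ∑' k, siteGenerator p α D k f x

/-- Bounded continuous functions of finitely many coordinates. -/
structure IsLocalTest {d : ℕ} (f : Config d → ℝ) : Prop where
  continuous : Continuous f
  bounded : ∃ C : ℝ, ∀ x, |f x| ≤ C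
  finitely_many : ∃ Λ : Finset (Site d), DependsOn f (Λ : Set (Site d))

/-- A (time homogeneous) Markov transition function: Markov kernels `P t` with `P 0` the identity
and the Chapman-Kolmogorov equations. -/
structure IsTransitionFunction {E : Type*} [MeasurableSpace E] (P : ℝ≥0 → Kernel E E) : Prop where
  markov : ∀ t, IsMarkovKernel (P t)
  zero : P 0 = Kernel.id
  add : ∀ s t, P (s + t) = P t ∘ₖ P s

/-- The σ-algebra generated by `η s`, `s ≤ t`. -/
@[reducible] def past {Ω E : Type*} [MeasurableSpace E] (η : ℝ≥0 → Ω → E) (t : ℝ≥0) : MeasurableSpace Ω :=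
  ⨆ s : Set.Iic t, MeasurableSpace.comap (η s) inferInstance

/-- `η` is a Markov process under `μ`, with initial law `ν` and transition function `P`. -/
structure IsMarkovProcess {Ω E : Type*} [MeasurableSpace Ω] [MeasurableSpace E]
    (P : ℝ≥0 → Kernel E E) (ν : Measure E) (μ : Measure Ω) (η : ℝ≥0 → Ω → E) : Prop where
  measurable : ∀ t, Measurable (η t)
  initial : μ.map (η 0) = ν
  markov : ∀ (t u : ℝ≥0) (A : Set E), MeasurableSet A →
    μ[(η (t + u) ⁻¹' A).indicator (fun _ => (1 : ℝ)) | past η t]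
      =ᵐ[μ] fun ω => (P u (η t ω)).real A

end Harness

/-!
The heat bath at a site replaces one height by a mean of finitely many neighbouring heights plus
Gaussian noise. On bounded continuous functions it acts as a contraction `K k`, which fixes functions
that do not look at `k` and otherwise adds a bounded number `m` of sites to those a function looks at
(`IsLocalUpdate`). The generator is `∑ k, (K k - 1)`.

*The semigroup.* On a function of `a` sites the `n`-th power of the generator of a finite set of sites
has norm at most `∏ i < n, 2 (a + i m) ≤ n! (4 m) ^ n 2 ^ a`, whatever the finite set is. Hence the
exponential series converges for small times, uniformly in the finite set, and the semigroups of the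
finite dynamics converge on local functions. As they are contractions they converge on the uniform
closure of the local functions. The limits stay in that closure, so that small times compose to all
times (`IsLocalUpdate.exists_tendsto`). The same bound gives the derivative at time zero
(`IsLocalUpdate.norm_limitSemigroup_sub_le`).

*The transition laws.* A semigroup on functions is not enough, because the height space is not compact
and mass might escape. The weights `α ^ (|k - j| / R)` are excessive for the matrix `α p`, since `p`
has range `R`. So the sum of the absolute heights with these weights, plus a constant which accounts
for the data and the noise, is a Lyapunov function with exponential growth rate at most one for all
finite dynamics (`Harness.isLyapunov_weightedSum`). The Lyapunov function centred at `j` dominates the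
height at `j`, hence the laws of the finite dynamics are tight, and a limit point represents the
limiting semigroup (`exists_limitLaw`). Being lower semicontinuous, the Lyapunov functions are almost
surely finite under the limit law, which therefore lives on the growth class. The limit laws depend
measurably on the starting point and satisfy the Chapman-Kolmogorov equations, because local functions
determine measures (`exists_transitionFunction`).

*The process.* The growth class is a measurable set, hence a standard Borel space, and Kolmogorov's
extension theorem (`exists_isProjectiveLimit`) gives a Markov law on its paths. By the Markov property
the conditional expectations in question are almost surely equal to integrals against the transition
kernel, simultaneously along a given sequence of times, so that their limit is the derivative at time
zero (`Harness.ae_tendsto_condExp_sub`).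
-/

/-! ### Kolmogorov's extension theorem -/

/-- The full product `ι → K`, as a topological space with its Borel σ-algebra. For uncountable `ι`
that σ-algebra is larger than the product σ-algebra which `ι → K` itself carries; the compactness
of the space of probability measures needs the larger one. -/
def BorelPaths (ι K : Type*) := ι → K

section BorelPaths

variable {ι K : Type*} [TopologicalSpace K]

instance : TopologicalSpace (BorelPaths ι K) := inferInstanceAs (TopologicalSpace (ι → K))
instance [T2Space K] : T2Space (BorelPaths ι K) := inferInstanceAs (T2Space (ι → K))
instance [CompactSpace K] : CompactSpace (BorelPaths ι K) :=
  inferInstanceAs (CompactSpace (ι → K))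
instance : MeasurableSpace (BorelPaths ι K) := borel _
instance : BorelSpace (BorelPaths ι K) := ⟨rfl⟩

theorem BorelPaths.continuous_apply (i : ι) : Continuous fun y : BorelPaths ι K => y i :=
  _root_.continuous_apply (A := fun _ : ι => K) i

end BorelPaths

/-- Kolmogorov's extension theorem for a compact metrizable state space: extend every
finite-dimensional law arbitrarily to a Borel law on the compact space of all paths, and take a
limit point along the finite index sets. -/
theorem exists_isProjectiveLimit_of_compactSpace {ι K : Type*} [TopologicalSpace K]
    [CompactSpace K] [T2Space K] [SecondCountableTopology K] [MeasurableSpace K] [BorelSpace K]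
    [Nonempty K] (P : ∀ J : Finset ι, Measure (J → K)) [∀ J, IsProbabilityMeasure (P J)]
    (hP : IsProjectiveMeasureFamily (α := fun _ => K) P) :
    ∃ μ : Measure (ι → K), IsProbabilityMeasure μ ∧ IsProjectiveLimit μ P := by
  classical
  have : TopologicalSpace.MetrizableSpace K :=
    TopologicalSpace.metrizableSpace_of_t3_secondCountable K
  obtain ⟨k₀⟩ := ‹Nonempty K›
  let ext (J : Finset ι) (y : J → K) : BorelPaths ι K :=
    fun i => if h : i ∈ J then y ⟨i, h⟩ else k₀
  have hext (J : Finset ι) : Continuous (ext J) := by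
    refine continuous_pi fun i => ?_
    by_cases h : i ∈ J
    · simpa [ext, h] using _root_.continuous_apply _
    · simpa [ext, h] using continuous_const
  let res (J : Finset ι) (y : BorelPaths ι K) : J → K := fun i => y i
  have hres (J : Finset ι) : Continuous (res J) :=
    continuous_pi fun i => BorelPaths.continuous_apply (K := K) (i : ι)
  let m (J : Finset ι) : ProbabilityMeasure (BorelPaths ι K) :=
    ⟨(P J).map (ext J), Measure.isProbabilityMeasure_map (hext J).measurable.aemeasurable⟩
  let F : Ultrafilter (Finset ι) := Ultrafilter.of atTop
  have hF : (F : Filter (Finset ι)) ≤ atTop := Ultrafilter.of_le _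
  obtain ⟨μ, -, hμ⟩ := isCompact_univ.ultrafilter_le_nhds (F.map m) (by simp)
  have hμ : Tendsto m F (𝓝 μ) := hμ
  have key (J : Finset ι) : (μ : Measure (BorelPaths ι K)).map (res J) = P J := by
    have h1 : Tendsto (fun I => (m I).map (hres J).measurable.aemeasurable) F
        (𝓝 (μ.map (hres J).measurable.aemeasurable)) :=
      ((ProbabilityMeasure.continuous_map (hres J)).tendsto μ).comp hμ
    have h2 : ∀ᶠ I in (F : Filter (Finset ι)),
        (m I).map (hres J).measurable.aemeasurable = ⟨P J, inferInstance⟩ := by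
      filter_upwards [hF (eventually_ge_atTop J)] with I hI
      apply Subtype.ext
      change ((P I).map (ext I)).map (res J) = P J
      rw [Measure.map_map (hres J).measurable (hext I).measurable, hP I J hI]
      congr 1
      ext y j
      exact dif_pos (hI j.2)
    have h3 := tendsto_nhds_unique h1 (tendsto_const_nhds.congr' (h2.mono fun _ h => h.symm))
    exact congrArg Subtype.val h3
  let idm (y : BorelPaths ι K) : ι → K := y
  have hid : Measurable idm :=
    measurable_pi_lambda _ fun i => (BorelPaths.continuous_apply (K := K) i).measurable
  refine ⟨(μ : Measure (BorelPaths ι K)).map idm,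
    Measure.isProbabilityMeasure_map hid.aemeasurable, fun J => ?_⟩
  rw [Measure.map_map (Finset.measurable_restrict J) hid]
  exact key J

/-- Kolmogorov's extension theorem for an arbitrary index set and a standard Borel state space,
which is reduced to a compact state space by a measurable embedding into the extended reals. -/
theorem exists_isProjectiveLimit {ι X : Type*} [MeasurableSpace X] [StandardBorelSpace X]
    [Nonempty X] (P : ∀ J : Finset ι, Measure (J → X)) [∀ J, IsProbabilityMeasure (P J)]
    (hP : IsProjectiveMeasureFamily (α := fun _ => X) P) :
    ∃ μ : Measure (ι → X), IsProbabilityMeasure μ ∧ IsProjectiveLimit μ P := by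
  obtain ⟨e₀, he₀⟩ := exists_measurableEmbedding_real X
  let e : X → EReal := fun x => (e₀ x : EReal)
  have he : Measurable e := measurable_coe_real_ereal.comp he₀.measurable
  let g : EReal → X := fun r => he₀.invFun r.toReal
  have hg : Measurable g := he₀.measurable_invFun.comp measurable_ereal_toReal
  have hge (x : X) : g (e x) = x := by simp [g, e, he₀.leftInverse_invFun x]
  let E (J : Finset ι) (y : J → X) : J → EReal := fun i => e (y i)
  have hE (J : Finset ι) : Measurable (E J) :=
    measurable_pi_lambda _ fun i => he.comp (measurable_pi_apply i)
  have (J : Finset ι) : IsProbabilityMeasure ((P J).map (E J)) :=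
    Measure.isProbabilityMeasure_map (hE J).aemeasurable
  obtain ⟨μ, hμ, hlim⟩ := exists_isProjectiveLimit_of_compactSpace
    (fun J => (P J).map (E J)) (by
      intro I J hJI
      have hr := Finset.measurable_restrict₂ (X := fun _ : ι => EReal) hJI
      have hr' := Finset.measurable_restrict₂ (X := fun _ : ι => X) hJI
      dsimp only
      rw [hP I J hJI, Measure.map_map (hE J) hr', Measure.map_map hr (hE I)]
      rfl)
  let G (y : ι → EReal) : ι → X := fun i => g (y i)
  have hG : Measurable G := measurable_pi_lambda _ fun i => hg.comp (measurable_pi_apply i)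
  refine ⟨μ.map G, Measure.isProbabilityMeasure_map hG.aemeasurable, fun J => ?_⟩
  let GJ (y : J → EReal) : J → X := fun i => g (y i)
  have hGJ : Measurable GJ := measurable_pi_lambda _ fun i => hg.comp (measurable_pi_apply i)
  have h1 : (J.restrict ∘ G : (ι → EReal) → J → X) = GJ ∘ J.restrict := rfl
  rw [Measure.map_map (Finset.measurable_restrict J) hG, h1,
    ← Measure.map_map hGJ (Finset.measurable_restrict J), hlim J, Measure.map_map hGJ (hE J)]
  have h2 : GJ ∘ E J = id := by ext y i; exact hge _
  rw [h2, Measure.map_id]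

/-! ### Markov processes with a given transition function -/

section MarkovLaw

variable {X : Type*} [MeasurableSpace X]

/-- A law on paths indexed by `ℝ≥0` that has the Markov property with transition function `P` and
initial law `ν` at the times in `J`: conditionally on finitely many times in `J` up to `t ∈ J`, the
state at a later time `t' ∈ J` is distributed by `P (t' - t)`. Nothing is asked at other times. -/
structure IsMarkovLaw (P : ℝ≥0 → Kernel X X) (ν : Measure X) (J : Finset ℝ≥0)
    (ρ : Measure (ℝ≥0 → X)) : Prop where
  isProbabilityMeasure : IsProbabilityMeasure ρ
  initial : ρ.map (fun ω => ω 0) = ν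
  markov : ∀ (I : Finset ℝ≥0) (t t' : ℝ≥0), I ⊆ J → t ∈ J → t' ∈ J → (∀ r ∈ I, r ≤ t) → t ≤ t' →
    ∀ B : Set (I → X), MeasurableSet B →
      (ρ.restrict (I.restrict ⁻¹' B)).map (fun ω => ω t')
        = P (t' - t) ∘ₘ (ρ.restrict (I.restrict ⁻¹' B)).map (fun ω => ω t)

variable {P : ℝ≥0 → Kernel X X} {ν : Measure X} {J J' : Finset ℝ≥0} {ρ ρ' : Measure (ℝ≥0 → X)}

theorem IsMarkovLaw.mono (h : IsMarkovLaw P ν J' ρ) (hJ : J ⊆ J') : IsMarkovLaw P ν J ρ :=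
  ⟨h.isProbabilityMeasure, h.initial, fun I t t' hI ht ht' hr htt' B hB =>
    h.markov I t t' (hI.trans hJ) (hJ ht) (hJ ht') hr htt' B hB⟩

theorem map_restrict_eq_of_subset {I : Finset ℝ≥0} (hIJ : I ⊆ J)
    (h : ρ.map J.restrict = ρ'.map J.restrict) : ρ.map I.restrict = ρ'.map I.restrict := by
  have h1 (ρ : Measure (ℝ≥0 → X)) :
      ρ.map I.restrict = (ρ.map J.restrict).map (Finset.restrict₂ (π := fun _ : ℝ≥0 => X) hIJ) := by
    rw [Measure.map_map (Finset.measurable_restrict₂ hIJ) (Finset.measurable_restrict J)]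
    rfl
  rw [h1 ρ, h1 ρ', h]

/-- Two laws with the same marginal on `J`, both restricted to an event that depends on the times
in `J`, give the same law to the coordinate at a time in `J`. -/
theorem map_eval_restrict_eq (h : ρ.map J.restrict = ρ'.map J.restrict) {t : ℝ≥0} (ht : t ∈ J)
    {I : Finset ℝ≥0} (hI : I ⊆ J) {B : Set (I → X)} (hB : MeasurableSet B) :
    (ρ.restrict (I.restrict ⁻¹' B)).map (fun ω => ω t)
      = (ρ'.restrict (I.restrict ⁻¹' B)).map (fun ω => ω t) := by
  have hJ := Finset.measurable_restrict (X := fun _ : ℝ≥0 => X) J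
  have hIm := Finset.measurable_restrict (X := fun _ : ℝ≥0 => X) I
  have hIJ := Finset.measurable_restrict₂ (X := fun _ : ℝ≥0 => X) hI
  ext A hA
  have h1 (ρ : Measure (ℝ≥0 → X)) : (ρ.restrict (I.restrict ⁻¹' B)).map (fun ω => ω t) A
      = ρ.map J.restrict ((fun y => y ⟨t, ht⟩) ⁻¹' A ∩
          Finset.restrict₂ (π := fun _ : ℝ≥0 => X) hI ⁻¹' B) := by
    rw [Measure.map_apply (measurable_pi_apply t) hA,
      Measure.restrict_apply (measurable_pi_apply t hA), Measure.map_apply hJ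
        ((measurable_pi_apply _ hA).inter (hIJ hB))]
    rfl
  rw [h1, h1, h]

theorem IsMarkovLaw.congr (h : IsMarkovLaw P ν J ρ) (h0 : 0 ∈ J) [IsProbabilityMeasure ρ']
    (hρ : ρ.map J.restrict = ρ'.map J.restrict) : IsMarkovLaw P ν J ρ' := by
  refine ⟨inferInstance, ?_, fun I t t' hI ht ht' hr htt' B hB => ?_⟩
  · have := map_eval_restrict_eq hρ h0 (Finset.empty_subset J) MeasurableSet.univ
    simp only [Set.preimage_univ, Measure.restrict_univ] at this
    rw [← this, h.initial]
  · rw [← map_eval_restrict_eq hρ ht hI hB, ← map_eval_restrict_eq hρ ht' hI hB]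
    exact h.markov I t t' hI ht ht' hr htt' B hB

/-- The Markov property determines the finite-dimensional law. -/
theorem IsMarkovLaw.map_restrict_eq (h0 : 0 ∈ J) (h : IsMarkovLaw P ν J ρ)
    (h' : IsMarkovLaw P ν J ρ') : ρ.map J.restrict = ρ'.map J.restrict := by
  suffices H : ∀ K : Finset ℝ≥0, insert 0 K ⊆ J →
      ρ.map (insert 0 K).restrict = ρ'.map (insert 0 K).restrict by
    have := H J (by simp [h0])
    rwa [Finset.insert_eq_of_mem h0] at this
  have := h.isProbabilityMeasure
  have := h'.isProbabilityMeasure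
  intro K
  refine Finset.induction_on_max K ?_ fun a K hK ih => ?_
  · intro _
    have e : (Finset.restrict (insert 0 (∅ : Finset ℝ≥0)) : (ℝ≥0 → X) → _)
        = (fun (x : X) _ => x) ∘ fun ω => ω 0 := by
      ext ω ⟨i, hi⟩
      have : i = 0 := by simpa using hi
      simp [Finset.restrict, this]
    have hm : Measurable (fun (x : X) (_ : (insert 0 (∅ : Finset ℝ≥0) : Finset ℝ≥0)) => x) :=
      measurable_pi_lambda _ fun _ => measurable_id
    rw [e, ← Measure.map_map hm (measurable_pi_apply 0), ← Measure.map_map hm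
      (measurable_pi_apply 0), h.initial, h'.initial]
  · intro hsub
    by_cases ha0 : a ∈ insert 0 K
    · have e : insert 0 (insert a K) = insert 0 K := by
        rw [Finset.insert_comm, Finset.insert_eq_of_mem ha0]
      rw [e] at hsub ⊢
      exact ih hsub
    set I := insert 0 K with hI
    have hIsub : I ⊆ insert 0 (insert a K) := by
      intro i hi
      simp only [hI, Finset.mem_insert] at hi ⊢
      tauto
    have hIJ : I ⊆ J := hIsub.trans hsub
    have IH := ih hIJ
    have haJ : a ∈ J := hsub (by simp)
    obtain ⟨b, hbI, hbmax⟩ : ∃ b ∈ I, ∀ r ∈ I, r ≤ b :=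
      ⟨I.max' ⟨0, by simp [hI]⟩, Finset.max'_mem _ _, fun r hr => Finset.le_max' _ r hr⟩
    have hba : b ≤ a := by
      rcases Finset.mem_insert.1 hbI with rfl | hb
      · exact zero_le
      · exact (hK b hb).le
    have key (B : Set (I → X)) (hB : MeasurableSet B) :
        (ρ.restrict (I.restrict ⁻¹' B)).map (fun ω => ω a)
          = (ρ'.restrict (I.restrict ⁻¹' B)).map (fun ω => ω a) := by
      rw [h.markov I b a hIJ (hIJ hbI) haJ hbmax hba B hB,
        h'.markov I b a hIJ (hIJ hbI) haJ hbmax hba B hB,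
        map_eval_restrict_eq IH hbI subset_rfl hB]
    -- the pair of the path on `I` and the state at `a` has the same law under `ρ` and `ρ'`
    have hIm := Finset.measurable_restrict (X := fun _ : ℝ≥0 => X) I
    have hpm : Measurable fun ω : ℝ≥0 → X => (I.restrict ω, ω a) :=
      hIm.prodMk (measurable_pi_apply a)
    have pair : ρ.map (fun ω => (I.restrict ω, ω a)) = ρ'.map (fun ω => (I.restrict ω, ω a)) := by
      have := Measure.isProbabilityMeasure_map (μ := ρ) hpm.aemeasurable
      have := Measure.isProbabilityMeasure_map (μ := ρ') hpm.aemeasurable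
      refine Measure.ext_prod_iff.2 fun {B A} hB hA => ?_
      have h1 (ρ : Measure (ℝ≥0 → X)) : ρ.map (fun ω => (I.restrict ω, ω a)) (B ×ˢ A)
          = (ρ.restrict (I.restrict ⁻¹' B)).map (fun ω => ω a) A := by
        rw [Measure.map_apply hpm (hB.prod hA), Measure.map_apply (measurable_pi_apply a) hA,
          Measure.restrict_apply (measurable_pi_apply a hA), Set.inter_comm]
        rfl
      rw [h1, h1, key B hB]
    let c (z : (I → X) × X) (i : (insert 0 (insert a K) : Finset ℝ≥0)) : X :=
      if hi : (i : ℝ≥0) ∈ I then z.1 ⟨i, hi⟩ else z.2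
    have hc : Measurable c := measurable_pi_lambda _ fun i => by
      by_cases hi : (i : ℝ≥0) ∈ I
      · simpa [c, hi, Function.comp_def] using (measurable_pi_apply _).comp measurable_fst
      · simpa [c, hi] using measurable_snd
    have e : (Finset.restrict (insert 0 (insert a K)) : (ℝ≥0 → X) → _)
        = c ∘ fun ω => (I.restrict ω, ω a) := by
      ext ω ⟨i, hi⟩
      by_cases hiI : i ∈ I
      · simp [c, hiI, Finset.restrict]
      · have : i = a := by
          simp only [Finset.mem_insert, hI] at hi hiI
          tauto
        subst this
        simp [c, hiI, Finset.restrict]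
    rw [e, ← Measure.map_map hc hpm, ← Measure.map_map hc hpm, pair]

/-- Markov laws on finitely many times exist: the state at a new last time `a` is drawn from
`P (a - b)`, started at the state at the previous last time `b`. -/
theorem exists_isMarkovLaw (hP : Harness.IsTransitionFunction P) (ν : Measure X)
    [IsProbabilityMeasure ν] (K : Finset ℝ≥0) :
    ∃ ρ : Measure (ℝ≥0 → X), IsMarkovLaw P ν (insert 0 K) ρ := by
  have := hP.markov
  refine Finset.induction_on_max K ?_ fun a K hK ih => ?_
  · have hm : Measurable (fun (x : X) (_ : ℝ≥0) => x) :=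
      measurable_pi_lambda _ fun _ => measurable_id
    refine ⟨ν.map fun x _ => x, Measure.isProbabilityMeasure_map hm.aemeasurable, ?_, ?_⟩
    · rw [Measure.map_map (measurable_pi_apply 0) hm]
      exact Measure.map_id
    · intro I t t' _ ht ht' _ _ B _
      obtain rfl : t = 0 := by simpa using ht
      obtain rfl : t' = 0 := by simpa using ht'
      rw [tsub_self, hP.zero, Measure.id_comp]
  obtain ⟨ρ, h⟩ := ih
  by_cases ha0 : a ∈ insert 0 K
  · rw [Finset.insert_comm, Finset.insert_eq_of_mem ha0]
    exact ⟨ρ, h⟩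
  set I := insert 0 K with hI
  have hKI : insert 0 (insert a K) = insert a I := Finset.insert_comm _ _ _
  obtain ⟨b, hbI, hbmax⟩ : ∃ b ∈ I, ∀ r ∈ I, r ≤ b :=
    ⟨I.max' ⟨0, by simp [hI]⟩, Finset.max'_mem _ _, fun r hr => Finset.le_max' _ r hr⟩
  have hba : b < a := by
    rcases Finset.mem_insert.1 hbI with rfl | hb
    · exact pos_iff_ne_zero.2 fun h => ha0 (by simp [hI, h])
    · exact hK b hb
  have := h.isProbabilityMeasure
  let κ : Kernel (ℝ≥0 → X) X := (P (a - b)).comap (fun ω => ω b) (measurable_pi_apply b)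
  let up (z : (ℝ≥0 → X) × X) : ℝ≥0 → X := Function.update z.1 a z.2
  have hup : Measurable up := measurable_pi_lambda _ fun i => by
    by_cases hi : i = a
    · subst hi
      simpa [up] using measurable_snd
    · simpa [up, hi, Function.comp_def] using
        (measurable_pi_apply (X := fun _ : ℝ≥0 => X) i).comp (measurable_fst (β := X))
  have hρ₁ : IsProbabilityMeasure ((ρ ⊗ₘ κ).map up) :=
    Measure.isProbabilityMeasure_map hup.aemeasurable
  have hres (L : Finset ℝ≥0) (hL : L ⊆ I) (z : (ℝ≥0 → X) × X) :
      L.restrict (up z) = L.restrict z.1 := by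
    ext i
    have : (i : ℝ≥0) ≠ a := fun h => ha0 (h ▸ hL i.2)
    simp [up, Finset.restrict, this]
  have hmar : ρ.map I.restrict = ((ρ ⊗ₘ κ).map up).map I.restrict := by
    have e : I.restrict ∘ up = (I.restrict : (ℝ≥0 → X) → _) ∘ Prod.fst := by
      funext z
      exact hres I subset_rfl z
    rw [Measure.map_map (Finset.measurable_restrict I) hup, e,
      ← Measure.map_map (Finset.measurable_restrict I) measurable_fst]
    congr 1
    exact (Measure.fst_compProd ρ κ).symm
  have hlast (L : Finset ℝ≥0) (hL : L ⊆ I) (B : Set (L → X)) (hB : MeasurableSet B) :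
      (((ρ ⊗ₘ κ).map up).restrict (L.restrict ⁻¹' B)).map (fun ω => ω a)
        = P (a - b) ∘ₘ (ρ.restrict (L.restrict ⁻¹' B)).map (fun ω => ω b) := by
    have hLB : MeasurableSet ((L.restrict : (ℝ≥0 → X) → _) ⁻¹' B) :=
      Finset.measurable_restrict L hB
    ext A hA
    have e : up ⁻¹' ((fun ω => ω a) ⁻¹' A ∩ L.restrict ⁻¹' B) = (L.restrict ⁻¹' B) ×ˢ A := by
      ext z
      simp only [Set.mem_preimage, Set.mem_inter_iff, Set.mem_prod, hres L hL]
      simp [up, and_comm]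
    rw [Measure.map_apply (measurable_pi_apply a) hA,
      Measure.restrict_apply (measurable_pi_apply a hA),
      Measure.map_apply hup ((measurable_pi_apply a hA).inter hLB), e,
      Measure.compProd_apply_prod hLB hA, Measure.bind_apply hA (Kernel.aemeasurable _),
      lintegral_map (Kernel.measurable_coe _ hA) (measurable_pi_apply b)]
    rfl
  have h1 : IsMarkovLaw P ν I ((ρ ⊗ₘ κ).map up) := h.congr (by simp [hI]) hmar
  refine ⟨(ρ ⊗ₘ κ).map up, hρ₁, h1.initial, fun L t t' hL ht ht' hr htt' B hB => ?_⟩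
  rw [hKI] at hL ht ht'
  have hlt {s : ℝ≥0} (hs : s ∈ I) : s < a := (hbmax s hs).trans_lt hba
  have hmem {s : ℝ≥0} (hs : s ∈ insert a I) (hsa : s < a) : s ∈ I :=
    (Finset.mem_insert.1 hs).resolve_left hsa.ne
  rcases eq_or_ne t a with rfl | hta
  · obtain rfl : t' = t := le_antisymm
      ((Finset.mem_insert.1 ht').elim le_of_eq fun h => (hlt h).le) htt'
    rw [tsub_self, hP.zero, Measure.id_comp]
  have htI : t ∈ I := (Finset.mem_insert.1 ht).resolve_left hta
  have hLI : L ⊆ I := fun r hrL => hmem (hL hrL) ((hr r hrL).trans_lt (hlt htI))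
  rcases Finset.mem_insert.1 ht' with rfl | ht'I
  · rw [hlast L hLI B hB, h.markov L t b hLI htI hbI hr (hbmax t htI) B hB, Measure.comp_assoc,
      ← hP.add, map_eval_restrict_eq hmar htI hLI hB]
    congr 2
    rw [add_comm, tsub_add_tsub_cancel hba.le (hbmax t htI)]
  · exact h1.markov L t t' hLI htI ht'I hr htt' B hB

end MarkovLaw

/-! ### The process on path space -/

section MarkovProcess

variable {X : Type*} [MeasurableSpace X] {P : ℝ≥0 → Kernel X X} {ν : Measure X}

/-- A transition function on a standard Borel space and an initial law have a Markov process. The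
Markov property is stated on events of the past, as an identity of laws. -/
theorem exists_markovPathLaw [StandardBorelSpace X] (hP : Harness.IsTransitionFunction P)
    (ν : Measure X) [IsProbabilityMeasure ν] :
    ∃ μ : Measure (ℝ≥0 → X), IsProbabilityMeasure μ ∧ μ.map (fun ω => ω 0) = ν ∧
      ∀ (t u : ℝ≥0) (s : Set (ℝ≥0 → X)),
        MeasurableSet[Harness.past (fun (r : ℝ≥0) (ω : ℝ≥0 → X) => ω r) t] s →
        (μ.restrict s).map (fun ω => ω (t + u)) = P u ∘ₘ (μ.restrict s).map (fun ω => ω t) := by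
  have := hP.markov
  have : Nonempty X := nonempty_of_isProbabilityMeasure ν
  choose ρ hρ using fun J => exists_isMarkovLaw hP ν J
  have := fun J => (hρ J).isProbabilityMeasure
  have hprob (J : Finset ℝ≥0) : IsProbabilityMeasure ((ρ J).map J.restrict) :=
    Measure.isProbabilityMeasure_map (Finset.measurable_restrict J).aemeasurable
  obtain ⟨μ, hμ, hlim⟩ := exists_isProjectiveLimit (fun J => (ρ J).map J.restrict) (by
    intro I J hJI
    have h1 := IsMarkovLaw.map_restrict_eq (by simp) (hρ J)
      ((hρ I).mono (Finset.insert_subset_insert 0 hJI))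
    dsimp only
    rw [map_restrict_eq_of_subset (Finset.subset_insert 0 J) h1,
      Measure.map_map (Finset.measurable_restrict₂ hJI) (Finset.measurable_restrict I)]
    rfl)
  have hM (J : Finset ℝ≥0) : IsMarkovLaw P ν (insert 0 J) μ := by
    have h1 := hρ (insert 0 J)
    rw [Finset.insert_idem] at h1
    exact h1.congr (by simp) (hlim _).symm
  refine ⟨μ, hμ, (hM ∅).initial, fun t u s hs => ?_⟩
  have hle : Harness.past (fun (r : ℝ≥0) (ω : ℝ≥0 → X) => ω r) t ≤ MeasurableSpace.pi :=
    iSup_le fun r => (measurable_pi_apply (r : ℝ≥0)).comap_le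
  ext A hA
  let C : Set (Set (ℝ≥0 → X)) :=
    {s | ∃ I : Finset ℝ≥0, (∀ r ∈ I, r ≤ t) ∧ ∃ B : Set (I → X), MeasurableSet B ∧
      s = I.restrict ⁻¹' B}
  have hCm (s) (hs : s ∈ C) : MeasurableSet s := by
    obtain ⟨I, -, B, hB, rfl⟩ := hs
    exact Finset.measurable_restrict I hB
  have hkm : Measurable fun ω : ℝ≥0 → X => P u (ω t) A :=
    (Kernel.measurable_coe _ hA).comp (measurable_pi_apply t)
  have hLHS (s : Set (ℝ≥0 → X)) : (μ.restrict s).map (fun ω => ω (t + u)) A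
      = μ.restrict ((fun ω => ω (t + u)) ⁻¹' A) s := by
    have hA' : MeasurableSet ((fun ω : ℝ≥0 → X => ω (t + u)) ⁻¹' A) := measurable_pi_apply _ hA
    rw [Measure.map_apply (measurable_pi_apply _) hA, Measure.restrict_apply hA',
      Measure.restrict_apply' hA', Set.inter_comm]
  have hRHS (s : Set (ℝ≥0 → X)) (hs : MeasurableSet s) :
      (P u ∘ₘ (μ.restrict s).map (fun ω => ω t)) A
        = μ.withDensity (fun ω => P u (ω t) A) s := by
    rw [Measure.bind_apply hA (Kernel.aemeasurable _),
      lintegral_map (Kernel.measurable_coe _ hA) (measurable_pi_apply _), withDensity_apply _ hs]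
  have hC (s) (hs : s ∈ C) : μ.restrict ((fun ω => ω (t + u)) ⁻¹' A) s
      = μ.withDensity (fun ω => P u (ω t) A) s := by
    rw [← hLHS, ← hRHS s (hCm s hs)]
    obtain ⟨I, hI, B, hB, rfl⟩ := hs
    rw [(hM (insert t (insert (t + u) I))).markov I t (t + u) (fun i hi => by simp [hi]) (by simp)
      (by simp) hI le_self_add B hB, add_tsub_cancel_left]
  rw [hLHS, hRHS s (hle s hs)]
  refine ext_on_measurableSpace_of_generate_finite MeasurableSpace.pi C hC hle ?_ ?_ ?_ hs
  · apply le_antisymm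
    · refine iSup_le fun r => ?_
      rintro _ ⟨B, hB, rfl⟩
      have hB' : MeasurableSet B := hB
      refine MeasurableSpace.measurableSet_generateFrom ⟨{(r : ℝ≥0)}, fun q hq => ?_,
        (fun y => y ⟨r, by simp⟩) ⁻¹' B, measurable_pi_apply _ hB', rfl⟩
      rw [Finset.mem_singleton.1 hq]
      exact r.2
    · refine MeasurableSpace.generateFrom_le ?_
      rintro _ ⟨I, hI, B, hB, rfl⟩
      have hm : Measurable[Harness.past (fun (r : ℝ≥0) (ω : ℝ≥0 → X) => ω r) t]
          (I.restrict : (ℝ≥0 → X) → I → X) := by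
        refine @measurable_pi_lambda _ _ _ (_) _ _ fun i => ?_
        exact Measurable.of_comap_le (le_iSup (fun s : Set.Iic t =>
          MeasurableSpace.comap (fun ω : ℝ≥0 → X => ω s) inferInstance) ⟨i, hI i i.2⟩)
      exact hm hB
  · rintro _ ⟨I, hI, B, hB, rfl⟩ _ ⟨I', hI', B', hB', rfl⟩ -
    classical
    refine ⟨I ∪ I', fun r hr => (Finset.mem_union.1 hr).elim (hI r) (hI' r),
      Finset.restrict₂ (π := fun _ => X) Finset.subset_union_left ⁻¹' B ∩
        Finset.restrict₂ (π := fun _ => X) Finset.subset_union_right ⁻¹' B',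
      (Finset.measurable_restrict₂ _ hB).inter (Finset.measurable_restrict₂ _ hB'), rfl⟩
  · exact hC _ ⟨∅, by simp, Set.univ, .univ, rfl⟩

/-- The Markov property for bounded measurable functions. -/
theorem condExp_markov {Ω : Type*} [MeasurableSpace Ω] {μ : Measure Ω} [IsProbabilityMeasure μ]
    {η : ℝ≥0 → Ω → X} (hη : ∀ t, Measurable (η t)) (hP : ∀ t, IsMarkovKernel (P t)) {t u : ℝ≥0}
    (h : ∀ s : Set Ω, MeasurableSet[Harness.past η t] s →
      (μ.restrict s).map (η (t + u)) = P u ∘ₘ (μ.restrict s).map (η t))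
    {f : X → ℝ} (hf : Measurable f) {C : ℝ} (hC : ∀ x, |f x| ≤ C) :
    μ[fun ω => f (η (t + u) ω) | Harness.past η t] =ᵐ[μ] fun ω => ∫ y, f y ∂(P u (η t ω)) := by
  have hle : Harness.past η t ≤ ‹MeasurableSpace Ω› := iSup_le fun r => (hη r).comap_le
  have hint (m : Measure Ω) [IsFiniteMeasure m] (g : Ω → ℝ)
      (hg : Measurable g) (hgC : ∀ x, |g x| ≤ C) : Integrable g m :=
    Integrable.of_bound hg.aestronglyMeasurable C (ae_of_all _ hgC)
  have hgm : Measurable fun x => ∫ y, f y ∂(P u x) :=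
    (hf.stronglyMeasurable.integral_kernel).measurable
  have hgC (x : X) : |∫ y, f y ∂(P u x)| ≤ C := by
    have := norm_integral_le_of_norm_le_const (μ := P u x) (f := f) (ae_of_all _ hC)
    simpa using this
  have hηt : Measurable[Harness.past η t] (η t) := Measurable.of_comap_le
    (le_iSup (fun s : Set.Iic t => MeasurableSpace.comap (η s) inferInstance)
      ⟨t, Set.mem_Iic.2 le_rfl⟩)
  refine (ae_eq_condExp_of_forall_setIntegral_eq hle ?_ ?_ ?_ ?_).symm
  · exact hint μ _ (hf.comp (hη _)) fun ω => hC _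
  · intro s _ _
    exact hint (μ.restrict s) _ (hgm.comp (hη t)) fun ω => hgC _
  · intro s hs _
    have h1 : ∫ ω in s, f (η (t + u) ω) ∂μ = ∫ x, f x ∂((μ.restrict s).map (η (t + u))) :=
      (integral_map (hη _).aemeasurable hf.aestronglyMeasurable).symm
    have h2 : ∫ ω in s, (∫ y, f y ∂(P u (η t ω))) ∂μ
        = ∫ x, (∫ y, f y ∂(P u x)) ∂((μ.restrict s).map (η t)) :=
      (integral_map (hη t).aemeasurable hgm.aestronglyMeasurable).symm
    have : IsFiniteMeasure ((μ.restrict s).map (η t)) := Measure.isFiniteMeasure_map _ _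
    rw [h1, h2, h s hs, Measure.comp_eq_comp_const_apply, Kernel.integral_comp, Kernel.const_apply]
    exact Integrable.of_bound hf.aestronglyMeasurable C (ae_of_all _ hC)
  · exact (hgm.comp hηt).stronglyMeasurable.aestronglyMeasurable

end MarkovProcess

/-! ### Exponential of an infinite sum of local updates -/

section LocalUpdates

variable {S V : Type*} [NormedAddCommGroup V] [NormedSpace ℝ V]

/-- The generator of the dynamics in which only the sites in `Λ` are updated, each at rate one. -/
noncomputable def finiteGenerator (K : S → V →L[ℝ] V) (Λ : Finset S) : V →L[ℝ] V :=
  ∑ k ∈ Λ, (K k - 1)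

/-- The semigroup of the dynamics in which only the sites in `Λ` are updated. -/
noncomputable def finiteSemigroup (K : S → V →L[ℝ] V) (Λ : Finset S) (t : ℝ) : V →L[ℝ] V :=
  NormedSpace.exp (t • finiteGenerator K Λ)

variable {K : S → V →L[ℝ] V}

theorem finiteGenerator_apply (Λ : Finset S) (f : V) :
    finiteGenerator K Λ f = ∑ k ∈ Λ, (K k f - f) := by
  simp [finiteGenerator]

theorem finiteSemigroup_zero (Λ : Finset S) : finiteSemigroup K Λ 0 = 1 := by
  simp [finiteSemigroup, NormedSpace.exp_zero]

section Complete

variable [CompleteSpace V]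

theorem hasSum_exp_smul_apply (A : V →L[ℝ] V) (t : ℝ) (f : V) :
    HasSum (fun n : ℕ => ((n.factorial : ℝ)⁻¹ * t ^ n) • (A ^ n) f)
      (NormedSpace.exp (t • A) f) := by
  have h1 := NormedSpace.exp_series_hasSum_exp' (𝕂 := ℝ) (t • A)
  have h2 := (ContinuousLinearMap.apply ℝ V f).hasSum h1
  simpa only [smul_pow, smul_smul, ContinuousLinearMap.apply_apply, smul_apply] using h2

theorem hasSum_finiteSemigroup (Λ : Finset S) (t : ℝ) (f : V) :
    HasSum (fun n : ℕ => ((n.factorial : ℝ)⁻¹ * t ^ n) • (finiteGenerator K Λ ^ n) f)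
      (finiteSemigroup K Λ t f) :=
  hasSum_exp_smul_apply _ t f

theorem finiteSemigroup_add (Λ : Finset S) (s t : ℝ) :
    finiteSemigroup K Λ (s + t) = finiteSemigroup K Λ s * finiteSemigroup K Λ t := by
  let _ : NormedAlgebra ℚ (V →L[ℝ] V) := NormedAlgebra.restrictScalars ℚ ℝ _
  rw [finiteSemigroup, add_smul]
  exact NormedSpace.exp_add_of_commute
    (((Commute.refl (finiteGenerator K Λ)).smul_left s).smul_right t)

/-- The finite semigroup as a mixture of the powers of `∑ K k` with Poisson weights. -/
theorem hasSum_finiteSemigroup_poisson (Λ : Finset S) (t : ℝ) (f : V) :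
    HasSum (fun n : ℕ => (Real.exp (-(t * Λ.card)) * ((n.factorial : ℝ)⁻¹ * t ^ n)) •
      ((∑ k ∈ Λ, K k) ^ n) f) (finiteSemigroup K Λ t f) := by
  let _ : NormedAlgebra ℚ (V →L[ℝ] V) := NormedAlgebra.restrictScalars ℚ ℝ _
  have h0 : t • finiteGenerator K Λ
      = algebraMap ℝ (V →L[ℝ] V) (-(t * Λ.card)) + t • ∑ k ∈ Λ, K k := by
    ext g
    simp only [finiteGenerator, Finset.sum_sub_distrib, Algebra.algebraMap_eq_smul_one]
    simp [smul_sub, mul_smul, Nat.cast_smul_eq_nsmul]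
    abel
  have h3 : finiteSemigroup K Λ t
      = Real.exp (-(t * Λ.card)) • NormedSpace.exp (t • ∑ k ∈ Λ, K k) := by
    rw [finiteSemigroup, h0, NormedSpace.exp_add_of_commute (Algebra.commutes _ _),
      ← NormedSpace.algebraMap_exp_comm, ← Algebra.smul_def,
      Real.exp_eq_exp_ℝ]
  rw [h3]
  simpa only [smul_smul, smul_apply] using
    (hasSum_exp_smul_apply (∑ k ∈ Λ, K k) t f).const_smul (Real.exp (-(t * Λ.card)))

theorem norm_finiteSemigroup_apply_le (hK : ∀ k f, ‖K k f‖ ≤ ‖f‖) (Λ : Finset S) {t : ℝ}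
    (ht : 0 ≤ t) (f : V) : ‖finiteSemigroup K Λ t f‖ ≤ ‖f‖ := by
  have hpow (n : ℕ) : ‖((∑ k ∈ Λ, K k) ^ n) f‖ ≤ (Λ.card : ℝ) ^ n * ‖f‖ := by
    induction n with
    | zero => simp
    | succ n ih =>
      rw [pow_succ', mul_apply_eq_comp, sum_apply]
      refine (norm_sum_le _ _).trans ((Finset.sum_le_sum fun k _ => (hK k _).trans ih).trans ?_)
      rw [Finset.sum_const, nsmul_eq_mul, pow_succ']
      exact le_of_eq (by ring)
  have h1 : HasSum (fun n : ℕ => Real.exp (-(t * Λ.card)) *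
      (((n.factorial : ℝ)⁻¹ * (t * Λ.card) ^ n) * ‖f‖)) ‖f‖ := by
    have := ((NormedSpace.exp_series_hasSum_exp' (𝕂 := ℝ) (t * Λ.card)).mul_right ‖f‖).mul_left
      (Real.exp (-(t * Λ.card)))
    rw [← Real.exp_eq_exp_ℝ, ← mul_assoc, ← Real.exp_add, neg_add_cancel, Real.exp_zero,
      one_mul] at this
    simpa only [smul_eq_mul] using this
  refine (hasSum_finiteSemigroup_poisson Λ t f).norm_le_of_bounded h1 fun n => ?_
  rw [norm_smul, Real.norm_of_nonneg (by positivity)]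
  calc _ ≤ Real.exp (-(t * Λ.card)) * ((n.factorial : ℝ)⁻¹ * t ^ n) * ((Λ.card : ℝ) ^ n * ‖f‖) :=
        mul_le_mul_of_nonneg_left (hpow n) (by positivity)
    _ = _ := by ring

end Complete

variable [DecidableEq S] {dep : Finset S → Submodule ℝ V} {nb : S → Finset S} {m : ℕ}

/-- Contractions `K k` of a Banach space `V` of observables, one for every site `k`, with finite
range: `dep I` is the space of observables of the sites in `I`, the update at `k` does not change
observables which do not look at `k`, and it enlarges the set of sites which are looked at by no
more than the set `nb k`, of at most `m` sites. -/
structure IsLocalUpdate (K : S → V →L[ℝ] V) (dep : Finset S → Submodule ℝ V)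
    (nb : S → Finset S) (m : ℕ) : Prop where
  one_le : 1 ≤ m
  card_le : ∀ k, (nb k).card ≤ m
  mono : Monotone dep
  norm_le : ∀ k f, ‖K k f‖ ≤ ‖f‖
  eq_self : ∀ {I k f}, f ∈ dep I → k ∉ I → K k f = f
  mem : ∀ {I k f}, f ∈ dep I → K k f ∈ dep (I ∪ nb k)

namespace IsLocalUpdate

theorem finiteGenerator_apply_of_mem (h : IsLocalUpdate K dep nb m) {I : Finset S} {f : V}
    (hf : f ∈ dep I) (Λ : Finset S) :
    finiteGenerator K Λ f = ∑ k ∈ Λ ∩ I, (K k f - f) := by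
  rw [finiteGenerator_apply]
  refine (Finset.sum_subset Finset.inter_subset_left fun k hk hkI => ?_).symm
  rw [h.eq_self hf fun hI => hkI (Finset.mem_inter.2 ⟨hk, hI⟩), sub_self]

theorem sub_mem (h : IsLocalUpdate K dep nb m) {I : Finset S} {f : V} (hf : f ∈ dep I) (k : S) :
    K k f - f ∈ dep (I ∪ nb k) :=
  (dep _).sub_mem (h.mem hf) (h.mono Finset.subset_union_left hf)

/-- A term of the `n`-th power of the generator updates `n` sites, and the `i`-th of them is one
of at most `a + i * m` sites. -/
theorem norm_finiteGenerator_pow_apply_le (h : IsLocalUpdate K dep nb m) (Λ : Finset S) (n : ℕ) :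
    ∀ (a : ℕ) (I : Finset S) (f : V), f ∈ dep I → I.card ≤ a →
      ‖(finiteGenerator K Λ ^ n) f‖ ≤ (∏ i ∈ Finset.range n, (2 * (a + i * m) : ℝ)) * ‖f‖ := by
  induction n with
  | zero => intro a I f _ _; simp
  | succ n ih =>
    intro a I f hf ha
    have hterm (k : S) : ‖(finiteGenerator K Λ ^ n) (K k f - f)‖
        ≤ (∏ i ∈ Finset.range n, (2 * (a + (i + 1 : ℕ) * m) : ℝ)) * (2 * ‖f‖) := by
      refine (ih (a + m) (I ∪ nb k) _ (h.sub_mem hf k)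
        ((Finset.card_union_le _ _).trans (add_le_add ha (h.card_le k)))).trans ?_
      refine mul_le_mul (le_of_eq ?_) ?_ (norm_nonneg _)
        (Finset.prod_nonneg fun i _ => by positivity)
      · refine Finset.prod_congr rfl fun i _ => ?_
        push_cast
        ring
      · refine (norm_sub_le _ _).trans ?_
        linarith [h.norm_le k f]
    rw [pow_succ, mul_apply_eq_comp, h.finiteGenerator_apply_of_mem hf, map_sum]
    refine (norm_sum_le _ _).trans ((Finset.sum_le_sum fun k _ => hterm k).trans ?_)
    rw [Finset.sum_const, nsmul_eq_mul, Finset.prod_range_succ']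
    have h1 : ((Λ ∩ I).card : ℝ) ≤ a :=
      Nat.cast_le.2 ((Finset.card_le_card Finset.inter_subset_right).trans ha)
    have h2 : 0 ≤ (∏ i ∈ Finset.range n, (2 * (a + (i + 1 : ℕ) * m) : ℝ)) * (2 * ‖f‖) :=
      mul_nonneg (Finset.prod_nonneg fun i _ => by positivity) (by positivity)
    refine (mul_le_mul_of_nonneg_right h1 h2).trans (le_of_eq ?_)
    push_cast
    ring

/-- The powers of the generator grow like `n! (4 m) ^ n`, uniformly in `Λ`: the exponential series
has a positive radius of convergence, which does not depend on the observable. -/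
theorem norm_finiteGenerator_pow_apply_le' (h : IsLocalUpdate K dep nb m) (Λ : Finset S) (n : ℕ)
    {I : Finset S} {f : V} (hf : f ∈ dep I) :
    ‖(finiteGenerator K Λ ^ n) f‖ ≤ n.factorial * ((4 * m : ℝ) ^ n * (2 ^ I.card * ‖f‖)) := by
  refine (h.norm_finiteGenerator_pow_apply_le Λ n I.card I f hf le_rfl).trans ?_
  have h1 : (1 : ℝ) ≤ m := by exact_mod_cast h.one_le
  have hprod : (∏ i ∈ Finset.range n, (2 * (I.card + i * m) : ℝ))
      ≤ (2 * m) ^ n * ((I.card + 1).ascFactorial n : ℕ) := by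
    rw [Nat.ascFactorial_eq_prod_range, Nat.cast_prod, ← Finset.card_range n,
      ← Finset.prod_const, Finset.card_range, ← Finset.prod_mul_distrib]
    refine Finset.prod_le_prod (fun i _ => by positivity) fun i _ => ?_
    push_cast
    have : (I.card : ℝ) ≤ m * I.card := le_mul_of_one_le_left (by positivity) h1
    nlinarith
  have hasc : ((I.card + 1).ascFactorial n : ℝ) ≤ n.factorial * 2 ^ (I.card + n) := by
    rw [Nat.ascFactorial_eq_factorial_mul_choose]
    exact_mod_cast Nat.mul_le_mul_left _ (Nat.choose_le_two_pow _ _)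
  calc (∏ i ∈ Finset.range n, (2 * (I.card + i * m) : ℝ)) * ‖f‖
      ≤ ((2 * m) ^ n * (n.factorial * 2 ^ (I.card + n))) * ‖f‖ := by
        refine mul_le_mul_of_nonneg_right (hprod.trans ?_) (norm_nonneg _)
        exact mul_le_mul_of_nonneg_left hasc (by positivity)
    _ = n.factorial * ((4 * m : ℝ) ^ n * (2 ^ I.card * ‖f‖)) := by
        rw [show (4 * m : ℝ) = 2 * m * 2 by ring, mul_pow _ (2 : ℝ), pow_add]
        ring

/-- The terms of the exponential series are dominated by a geometric series. -/
theorem norm_expSeries_le (h : IsLocalUpdate K dep nb m) (Λ : Finset S) {t : ℝ} (ht : 0 ≤ t)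
    {I : Finset S} {f : V} (hf : f ∈ dep I) (n : ℕ) :
    ‖((n.factorial : ℝ)⁻¹ * t ^ n) • (finiteGenerator K Λ ^ n) f‖
      ≤ (4 * m * t) ^ n * (2 ^ I.card * ‖f‖) := by
  rw [norm_smul, Real.norm_of_nonneg (by positivity)]
  refine (mul_le_mul_of_nonneg_left (h.norm_finiteGenerator_pow_apply_le' Λ n hf)
    (by positivity)).trans (le_of_eq ?_)
  have : (n.factorial : ℝ) ≠ 0 := by positivity
  rw [mul_pow _ t]
  field_simp

theorem finiteGenerator_mem (h : IsLocalUpdate K dep nb m) {I : Finset S} {f : V}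
    (hf : f ∈ dep I) (Λ : Finset S) : ∃ J, finiteGenerator K Λ f ∈ dep J := by
  refine ⟨I ∪ Λ.biUnion nb, ?_⟩
  rw [finiteGenerator_apply]
  refine Submodule.sum_mem _ fun k hk => h.mono ?_ (h.sub_mem hf k)
  exact Finset.union_subset_union_right (Finset.subset_biUnion_of_mem nb hk)

theorem finiteGenerator_eq (h : IsLocalUpdate K dep nb m) {I Λ : Finset S} {f : V}
    (hf : f ∈ dep I) (hΛ : I ⊆ Λ) : finiteGenerator K Λ f = finiteGenerator K I f := by
  rw [h.finiteGenerator_apply_of_mem hf, h.finiteGenerator_apply_of_mem hf,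
    Finset.inter_eq_right.2 hΛ, Finset.inter_self]

/-- Every power of the generator, applied to a local observable, is eventually constant as `Λ`
grows. -/
theorem exists_finiteGenerator_pow_apply_eq (h : IsLocalUpdate K dep nb m) (n : ℕ) :
    ∀ (I : Finset S) (f : V), f ∈ dep I →
      ∃ J g, ∀ Λ : Finset S, J ⊆ Λ → (finiteGenerator K Λ ^ n) f = g := by
  induction n with
  | zero => intro I f _; exact ⟨∅, f, fun Λ _ => by simp⟩
  | succ n ih =>
    intro I f hf
    obtain ⟨I', hI'⟩ := h.finiteGenerator_mem hf I
    obtain ⟨J, g, hJ⟩ := ih I' _ hI'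
    refine ⟨I ∪ J, g, fun Λ hΛ => ?_⟩
    rw [pow_succ, mul_apply_eq_comp,
      h.finiteGenerator_eq hf (Finset.union_subset_left hΛ), hJ Λ (Finset.union_subset_right hΛ)]

end IsLocalUpdate

end LocalUpdates

/-! ### The semigroup of the infinite dynamics -/

section LimitSemigroup

variable {S V : Type*} [NormedAddCommGroup V] [NormedSpace ℝ V]

/-- The observables that are uniform limits of observables of finitely many sites. -/
def localClosure (dep : Finset S → Submodule ℝ V) : Submodule ℝ V :=
  (⨆ I, dep I).topologicalClosure

/-- The semigroup of the dynamics on all sites, as the limit of the finite semigroups. It has the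
junk value of `limUnder` where that limit does not exist. -/
noncomputable def limitSemigroup (K : S → V →L[ℝ] V) (t : ℝ) (f : V) : V :=
  limUnder atTop fun Λ : Finset S => finiteSemigroup K Λ t f

theorem mem_localClosure {dep : Finset S → Submodule ℝ V} {I : Finset S} {f : V}
    (hf : f ∈ dep I) : f ∈ localClosure dep :=
  Submodule.le_topologicalClosure _ (Submodule.mem_iSup_of_mem I hf)

theorem isClosed_localClosure (dep : Finset S → Submodule ℝ V) :
    IsClosed (localClosure dep : Set V) :=
  Submodule.isClosed_topologicalClosure _

/-- A closed property of observables that holds for local observables holds on their closure. -/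
theorem localClosure_induction [DecidableEq S] {dep : Finset S → Submodule ℝ V}
    (hmono : Monotone dep)
    {p : V → Prop} (hp : IsClosed {f | p f}) (h : ∀ I, ∀ f ∈ dep I, p f) {f : V}
    (hf : f ∈ localClosure dep) : p f := by
  have hf' : f ∈ closure ((⨆ I, dep I : Submodule ℝ V) : Set V) := hf
  refine closure_minimal (t := {f | p f}) (fun g hg => ?_) hp hf'
  obtain ⟨I, hI⟩ := (Submodule.mem_iSup_of_directed dep hmono.directed_le).1 hg
  exact h I g hI

variable [DecidableEq S] [CompleteSpace V] {K : S → V →L[ℝ] V} {dep : Finset S → Submodule ℝ V}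
  {nb : S → Finset S} {m : ℕ}

namespace IsLocalUpdate

theorem finiteSemigroup_mem (h : IsLocalUpdate K dep nb m) (Λ : Finset S) (t : ℝ) {f : V}
    (hf : f ∈ localClosure dep) : finiteSemigroup K Λ t f ∈ localClosure dep := by
  refine localClosure_induction (p := fun f => finiteSemigroup K Λ t f ∈ localClosure dep) h.mono
    ((isClosed_localClosure dep).preimage (finiteSemigroup K Λ t).continuous) ?_ hf
  intro I f hf
  have hpow (n : ℕ) : ∃ J, (finiteGenerator K Λ ^ n) f ∈ dep J := by
    induction n with
    | zero => exact ⟨I, by simpa using hf⟩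
    | succ n ih =>
      obtain ⟨J, hJ⟩ := ih
      rw [pow_succ', mul_apply_eq_comp]
      exact h.finiteGenerator_mem hJ Λ
  refine (isClosed_localClosure dep).mem_of_tendsto (hasSum_finiteSemigroup Λ t f)
    (Eventually.of_forall fun s => Submodule.sum_mem _ fun n _ => Submodule.smul_mem _ _ ?_)
  exact mem_localClosure (hpow n).choose_spec

/-- For small times the finite semigroups converge on a local observable: the exponential series is
dominated uniformly in `Λ`, and each of its terms is eventually constant. -/
theorem exists_tendsto_of_small (h : IsLocalUpdate K dep nb m) {t : ℝ} (ht : 0 ≤ t)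
    (htm : 8 * m * t ≤ 1) {I : Finset S} {f : V} (hf : f ∈ dep I) :
    ∃ g, Tendsto (fun Λ : Finset S => finiteSemigroup K Λ t f) atTop (𝓝 g) := by
  choose J g hJ using fun n => h.exists_finiteGenerator_pow_apply_eq n I f hf
  refine ⟨∑' n : ℕ, ((n.factorial : ℝ)⁻¹ * t ^ n) • g n, ?_⟩
  simp_rw [← (hasSum_finiteSemigroup _ t f).tsum_eq]
  refine tendsto_tsum_of_dominated_convergence
    (bound := fun n => (4 * m * t) ^ n * (2 ^ I.card * ‖f‖)) ?_ ?_ ?_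
  · exact (summable_geometric_of_lt_one (by positivity) (by linarith)).mul_right _
  · intro n
    refine tendsto_const_nhds.congr' ?_
    filter_upwards [eventually_ge_atTop (J n)] with Λ hΛ
    rw [hJ n Λ hΛ]
  · exact Eventually.of_forall fun Λ n => h.norm_expSeries_le Λ ht hf n

/-- Convergence passes from local observables to their uniform limits, since the finite semigroups
are contractions. -/
theorem exists_tendsto_of_forall_dep (h : IsLocalUpdate K dep nb m) {t : ℝ} (ht : 0 ≤ t)
    (hloc : ∀ I, ∀ f ∈ dep I,
      ∃ g, Tendsto (fun Λ : Finset S => finiteSemigroup K Λ t f) atTop (𝓝 g))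
    {f : V} (hf : f ∈ localClosure dep) :
    ∃ g, Tendsto (fun Λ : Finset S => finiteSemigroup K Λ t f) atTop (𝓝 g) := by
  refine cauchySeq_tendsto_of_complete ?_
  refine localClosure_induction
    (p := fun f => CauchySeq fun Λ : Finset S => finiteSemigroup K Λ t f) h.mono ?_
    (fun I f hf => (hloc I f hf).choose_spec.cauchySeq) hf
  refine isClosed_of_closure_subset fun f hf => Metric.cauchySeq_iff'.2 fun ε hε => ?_
  obtain ⟨g, hg, hfg⟩ := Metric.mem_closure_iff.1 hf (ε / 3) (by positivity)
  obtain ⟨N, hN⟩ := Metric.cauchySeq_iff'.1 hg (ε / 3) (by positivity)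
  have h1 (Λ : Finset S) : dist (finiteSemigroup K Λ t f) (finiteSemigroup K Λ t g) < ε / 3 := by
    rw [dist_eq_norm, ← map_sub]
    exact (norm_finiteSemigroup_apply_le h.norm_le Λ ht _).trans_lt (by rwa [← dist_eq_norm])
  refine ⟨N, fun Λ hΛ => ?_⟩
  have h2 := dist_triangle4 (finiteSemigroup K Λ t f) (finiteSemigroup K Λ t g)
    (finiteSemigroup K N t g) (finiteSemigroup K N t f)
  rw [dist_comm (finiteSemigroup K N t g)] at h2
  linarith [h1 Λ, h1 N, hN Λ hΛ]

theorem tendsto_finiteSemigroup_add (h : IsLocalUpdate K dep nb m) {s t : ℝ} (hs : 0 ≤ s)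
    {f g g' : V} (h1 : Tendsto (fun Λ : Finset S => finiteSemigroup K Λ t f) atTop (𝓝 g))
    (h2 : Tendsto (fun Λ : Finset S => finiteSemigroup K Λ s g) atTop (𝓝 g')) :
    Tendsto (fun Λ : Finset S => finiteSemigroup K Λ (s + t) f) atTop (𝓝 g') := by
  have h3 : Tendsto (fun Λ : Finset S =>
      finiteSemigroup K Λ s (finiteSemigroup K Λ t f - g)) atTop (𝓝 0) := by
    refine squeeze_zero_norm (fun Λ => norm_finiteSemigroup_apply_le h.norm_le Λ hs _) ?_
    simpa using (h1.sub_const g).norm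
  simpa [finiteSemigroup_add, mul_apply_eq_comp] using h3.add h2

/-- Large times are composed of small ones. The limit at a small time is no longer local, but it is
in the closure of the local observables, where the next small step converges too. -/
theorem exists_tendsto (h : IsLocalUpdate K dep nb m) {t : ℝ} (ht : 0 ≤ t) {f : V}
    (hf : f ∈ localClosure dep) :
    ∃ g ∈ localClosure dep,
      Tendsto (fun Λ : Finset S => finiteSemigroup K Λ t f) atTop (𝓝 g) := by
  have hmem {t : ℝ} {f g : V} (hf : f ∈ localClosure dep)
      (hg : Tendsto (fun Λ : Finset S => finiteSemigroup K Λ t f) atTop (𝓝 g)) :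
      g ∈ localClosure dep :=
    (isClosed_localClosure dep).mem_of_tendsto hg
      (Eventually.of_forall fun Λ => h.finiteSemigroup_mem Λ t hf)
  have hsmall {s : ℝ} (hs : 0 ≤ s) (hsm : 8 * m * s ≤ 1) {f : V} (hf : f ∈ localClosure dep) :=
    h.exists_tendsto_of_forall_dep hs (fun I f hf => h.exists_tendsto_of_small hs hsm hf) hf
  have hmul (s : ℝ) (hs : 0 ≤ s) (hsm : 8 * m * s ≤ 1) (n : ℕ) :
      ∀ f ∈ localClosure dep,
        ∃ g, Tendsto (fun Λ : Finset S => finiteSemigroup K Λ (n * s) f) atTop (𝓝 g) := by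
    induction n with
    | zero => intro f _; exact ⟨f, by simp [finiteSemigroup_zero]⟩
    | succ n ih =>
      intro f hf
      obtain ⟨g, hg⟩ := hsmall hs hsm hf
      obtain ⟨g', hg'⟩ := ih g (hmem hf hg)
      refine ⟨g', ?_⟩
      have := h.tendsto_finiteSemigroup_add (s := n * s) (by positivity) hg hg'
      rwa [show ((n + 1 : ℕ) : ℝ) * s = n * s + s by push_cast; ring]
  obtain ⟨n, hn⟩ := exists_nat_gt (8 * m * t)
  have hn0 : (0 : ℝ) < n := lt_of_le_of_lt (by positivity) hn
  obtain ⟨g, hg⟩ := hmul (t / n) (by positivity)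
    (by rw [← mul_div_assoc, div_le_one hn0]; exact hn.le) n f hf
  rw [mul_div_cancel₀ _ hn0.ne'] at hg
  exact ⟨g, hmem hf hg, hg⟩

theorem tendsto_limitSemigroup (h : IsLocalUpdate K dep nb m) {t : ℝ} (ht : 0 ≤ t) {f : V}
    (hf : f ∈ localClosure dep) :
    Tendsto (fun Λ : Finset S => finiteSemigroup K Λ t f) atTop (𝓝 (limitSemigroup K t f)) :=
  tendsto_nhds_limUnder ((h.exists_tendsto ht hf).imp fun _ => And.right)

theorem limitSemigroup_mem (h : IsLocalUpdate K dep nb m) {t : ℝ} (ht : 0 ≤ t) {f : V}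
    (hf : f ∈ localClosure dep) : limitSemigroup K t f ∈ localClosure dep :=
  (isClosed_localClosure dep).mem_of_tendsto (h.tendsto_limitSemigroup ht hf)
    (Eventually.of_forall fun Λ => h.finiteSemigroup_mem Λ t hf)

theorem limitSemigroup_zero (h : IsLocalUpdate K dep nb m) {f : V} (hf : f ∈ localClosure dep) :
    limitSemigroup K 0 f = f :=
  tendsto_nhds_unique (h.tendsto_limitSemigroup le_rfl hf) (by simp [finiteSemigroup_zero])

theorem limitSemigroup_add (h : IsLocalUpdate K dep nb m) {s t : ℝ} (hs : 0 ≤ s) (ht : 0 ≤ t)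
    {f : V} (hf : f ∈ localClosure dep) :
    limitSemigroup K (s + t) f = limitSemigroup K s (limitSemigroup K t f) :=
  tendsto_nhds_unique (h.tendsto_limitSemigroup (add_nonneg hs ht) hf)
    (h.tendsto_finiteSemigroup_add hs (h.tendsto_limitSemigroup ht hf)
      (h.tendsto_limitSemigroup hs (h.limitSemigroup_mem ht hf)))

/-- Second order expansion of the semigroup at time zero. -/
theorem norm_limitSemigroup_sub_le (h : IsLocalUpdate K dep nb m) {u : ℝ} (hu : 0 ≤ u)
    (hum : 8 * m * u ≤ 1) {I : Finset S} {f : V} (hf : f ∈ dep I) :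
    ‖limitSemigroup K u f - f - u • finiteGenerator K I f‖
      ≤ 2 * (4 * m) ^ 2 * (2 ^ I.card * ‖f‖) * u ^ 2 := by
  have hlim : Tendsto (fun Λ : Finset S => ‖finiteSemigroup K Λ u f - f
      - u • finiteGenerator K I f‖) atTop
      (𝓝 ‖limitSemigroup K u f - f - u • finiteGenerator K I f‖) :=
    (((h.tendsto_limitSemigroup hu (mem_localClosure hf)).sub_const f).sub_const _).norm
  refine le_of_tendsto hlim ?_
  filter_upwards [eventually_ge_atTop I] with Λ hΛ
  have h1 := (hasSum_nat_add_iff' 2).2 (hasSum_finiteSemigroup (K := K) Λ u f)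
  have h2 : finiteSemigroup K Λ u f - f - u • finiteGenerator K I f
      = finiteSemigroup K Λ u f - ∑ i ∈ Finset.range 2,
        ((i.factorial : ℝ)⁻¹ * u ^ i) • (finiteGenerator K Λ ^ i) f := by
    simp [Finset.sum_range_succ, h.finiteGenerator_eq hf hΛ, sub_sub]
  have hq : 4 * m * u ≤ 1 / 2 := by linarith
  have hq0 : 0 ≤ 4 * m * u := by positivity
  have h3 := ((hasSum_geometric_of_lt_one hq0 (by linarith)).mul_right
    ((4 * m * u) ^ 2 * (2 ^ I.card * ‖f‖)))
  rw [h2]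
  refine (h1.norm_le_of_bounded h3 fun n => ?_).trans ?_
  · refine (h.norm_expSeries_le Λ hu hf (n + 2)).trans (le_of_eq ?_)
    rw [pow_add]
    ring
  · have h4 : (1 - 4 * m * u)⁻¹ ≤ (2 : ℝ) := by
      rw [inv_le_comm₀ (by linarith) (by norm_num)]
      linarith
    refine (mul_le_mul_of_nonneg_right h4 (by positivity)).trans (le_of_eq ?_)
    ring

end IsLocalUpdate

end LimitSemigroup

/-! ### The laws of the finite dynamics -/

section FiniteLaw

open scoped BoundedContinuousFunction ENNReal

variable {S : Type*}

/-- The bounded continuous functions of the coordinates in `I`. -/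
def dependingOn (I : Finset S) : Submodule ℝ ((S → ℝ) →ᵇ ℝ) where
  carrier := {f | DependsOn f (I : Set S)}
  add_mem' hf hg x y h := by simp [hf h, hg h]
  zero_mem' x y _ := rfl
  smul_mem' c f hf x y h := by simp [hf h]

theorem mem_dependingOn {I : Finset S} {f : (S → ℝ) →ᵇ ℝ} :
    f ∈ dependingOn I ↔ DependsOn f (I : Set S) := Iff.rfl

/-- The image of the point mass at `x` under the `n`-th power of `∑ k ∈ Λ, κ k`. Its total mass is
the `n`-th power of the number of sites in `Λ`. -/
noncomputable def powerMeasure (κ : S → Kernel (S → ℝ) (S → ℝ)) (Λ : Finset S) (x : S → ℝ) :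
    ℕ → Measure (S → ℝ)
  | 0 => Measure.dirac x
  | n + 1 => ∑ k ∈ Λ, κ k ∘ₘ powerMeasure κ Λ x n

/-- The law at time `t` of the dynamics in which only the sites in `Λ` are updated: the number of
updates is Poisson, and the sites of the updates are chosen uniformly. -/
noncomputable def finiteLaw (κ : S → Kernel (S → ℝ) (S → ℝ)) (Λ : Finset S) (t : ℝ)
    (x : S → ℝ) : Measure (S → ℝ) :=
  Measure.sum fun n : ℕ =>
    ENNReal.ofReal (Real.exp (-(t * Λ.card)) * ((n.factorial : ℝ)⁻¹ * t ^ n)) •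
      powerMeasure κ Λ x n

variable {κ : S → Kernel (S → ℝ) (S → ℝ)} {Λ : Finset S} {t : ℝ} {x : S → ℝ}

theorem lintegral_powerMeasure_le {W : (S → ℝ) → ℝ≥0∞} (hW : Measurable W) {c : ℝ≥0∞}
    (h : ∀ y, ∑ k ∈ Λ, ∫⁻ z, W z ∂(κ k y) ≤ c * W y) (n : ℕ) :
    ∫⁻ y, W y ∂(powerMeasure κ Λ x n) ≤ c ^ n * W x := by
  induction n with
  | zero => simp [powerMeasure, lintegral_dirac' x hW]
  | succ n ih =>
    rw [powerMeasure, lintegral_finsetSum_measure]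
    simp_rw [Measure.lintegral_bind (Kernel.aemeasurable _) hW.aemeasurable]
    rw [← lintegral_finsetSum _ fun k _ => hW.lintegral_kernel]
    refine (lintegral_mono h).trans ?_
    rw [lintegral_const_mul _ hW, pow_succ', mul_assoc]
    gcongr

theorem lintegral_finiteLaw_le {W : (S → ℝ) → ℝ≥0∞} (hW : Measurable W) {c : ℝ≥0}
    (h : ∀ y, ∑ k ∈ Λ, ∫⁻ z, W z ∂(κ k y) ≤ c * W y) (ht : 0 ≤ t) :
    ∫⁻ y, W y ∂(finiteLaw κ Λ t x) ≤ ENNReal.ofReal (Real.exp (t * (c - Λ.card))) * W x := by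
  rw [finiteLaw, lintegral_sum_measure]
  have h1 : HasSum (fun n : ℕ => Real.exp (-(t * Λ.card)) * ((n.factorial : ℝ)⁻¹ * (t * c) ^ n))
      (Real.exp (t * (c - Λ.card))) := by
    have := (NormedSpace.exp_series_hasSum_exp' (𝕂 := ℝ) (t * c)).mul_left
      (Real.exp (-(t * Λ.card)))
    rw [← Real.exp_eq_exp_ℝ, ← Real.exp_add] at this
    rw [show t * (c - Λ.card) = -(t * Λ.card) + t * c by ring]
    simpa only [smul_eq_mul] using this
  rw [← h1.tsum_eq, ENNReal.ofReal_tsum_of_nonneg (fun n => by positivity) h1.summable,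
    ← ENNReal.tsum_mul_right]
  refine ENNReal.tsum_le_tsum fun n => ?_
  have h2 : Real.exp (-(t * Λ.card)) * ((n.factorial : ℝ)⁻¹ * (t * c) ^ n)
      = Real.exp (-(t * Λ.card)) * ((n.factorial : ℝ)⁻¹ * t ^ n) * (c : ℝ) ^ n := by
    rw [mul_pow]
    ring
  rw [lintegral_smul_measure, smul_eq_mul, h2,
    ENNReal.ofReal_mul (q := (c : ℝ) ^ n) (by positivity), ENNReal.ofReal_pow c.coe_nonneg, ENNReal.ofReal_coe_nnreal, mul_assoc]
  gcongr
  exact lintegral_powerMeasure_le hW h n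

variable [∀ k, IsMarkovKernel (κ k)]

theorem finiteLaw_univ_le (ht : 0 ≤ t) : finiteLaw κ Λ t x Set.univ ≤ 1 := by
  have := lintegral_finiteLaw_le (κ := κ) (Λ := Λ) (x := x) (W := fun _ => 1) measurable_const
    (c := Λ.card) (by simp) ht
  simpa using this

theorem isFiniteMeasure_powerMeasure (n : ℕ) : IsFiniteMeasure (powerMeasure κ Λ x n) := by
  constructor
  have := lintegral_powerMeasure_le (κ := κ) (Λ := Λ) (x := x) (W := fun _ => 1) measurable_const
    (c := Λ.card) (by simp) n
  simp only [lintegral_one, mul_one] at this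
  exact this.trans_lt (by finiteness)

variable [Countable S] {K : S → ((S → ℝ) →ᵇ ℝ) →L[ℝ] ((S → ℝ) →ᵇ ℝ)}

theorem integral_powerMeasure (hK : ∀ k f y, K k f y = ∫ z, f z ∂(κ k y)) (n : ℕ) :
    ∀ f : (S → ℝ) →ᵇ ℝ, ∫ y, f y ∂(powerMeasure κ Λ x n) = ((∑ k ∈ Λ, K k) ^ n) f x := by
  induction n with
  | zero => intro f; simp [powerMeasure]
  | succ n ih =>
    intro f
    have := isFiniteMeasure_powerMeasure (κ := κ) (Λ := Λ) (x := x) n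
    rw [powerMeasure, integral_finsetSum_measure fun k _ => f.integrable _, pow_succ,
      mul_apply_eq_comp, ← ih, sum_apply]
    simp_rw [Measure.comp_eq_comp_const_apply,
      Kernel.integral_comp (f.integrable _), Kernel.const_apply, ← hK]
    rw [← integral_finsetSum _ fun k _ => (K k f).integrable _]
    simp

theorem integral_finiteLaw (hK : ∀ k f y, K k f y = ∫ z, f z ∂(κ k y)) (ht : 0 ≤ t)
    (f : (S → ℝ) →ᵇ ℝ) : ∫ y, f y ∂(finiteLaw κ Λ t x) = finiteSemigroup K Λ t f x := by
  have : IsFiniteMeasure (finiteLaw κ Λ t x) := ⟨(finiteLaw_univ_le ht).trans_lt (by simp)⟩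
  have h1 := hasSum_integral_measure (μ := fun n : ℕ =>
    ENNReal.ofReal (Real.exp (-(t * Λ.card)) * ((n.factorial : ℝ)⁻¹ * t ^ n)) •
      powerMeasure κ Λ x n) (f := f) (f.integrable (finiteLaw κ Λ t x))
  have h2 := (BoundedContinuousFunction.evalCLM ℝ x).hasSum
    (hasSum_finiteSemigroup_poisson (K := K) Λ t f)
  have h3 (n : ℕ) : ∫ y, f y ∂(ENNReal.ofReal (Real.exp (-(t * Λ.card)) *
      ((n.factorial : ℝ)⁻¹ * t ^ n)) • powerMeasure κ Λ x n)
      = BoundedContinuousFunction.evalCLM ℝ x ((Real.exp (-(t * Λ.card)) *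
        ((n.factorial : ℝ)⁻¹ * t ^ n)) • ((∑ k ∈ Λ, K k) ^ n) f) := by
    rw [integral_smul_measure, integral_powerMeasure hK, ENNReal.toReal_ofReal (by positivity)]
    simp
  simp_rw [h3] at h1
  exact h1.unique h2

theorem isProbabilityMeasure_finiteLaw (hK : ∀ k f y, K k f y = ∫ z, f z ∂(κ k y)) (ht : 0 ≤ t) :
    IsProbabilityMeasure (finiteLaw κ Λ t x) := by
  have : IsFiniteMeasure (finiteLaw κ Λ t x) := ⟨(finiteLaw_univ_le ht).trans_lt (by simp)⟩
  have h1 := integral_finiteLaw (Λ := Λ) (x := x) hK ht (1 : (S → ℝ) →ᵇ ℝ)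
  have hgen : finiteGenerator K Λ (1 : (S → ℝ) →ᵇ ℝ) = 0 := by
    rw [finiteGenerator_apply]
    refine Finset.sum_eq_zero fun k _ => ?_
    ext y
    simp [hK]
  have h2 : finiteSemigroup K Λ t (1 : (S → ℝ) →ᵇ ℝ) = 1 := by
    refine (hasSum_finiteSemigroup Λ t _).unique ?_
    have := hasSum_single (f := fun n : ℕ => ((n.factorial : ℝ)⁻¹ * t ^ n) •
      (finiteGenerator K Λ ^ n) (1 : (S → ℝ) →ᵇ ℝ)) 0 fun n hn => by
        obtain ⟨n, rfl⟩ := Nat.exists_eq_succ_of_ne_zero hn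
        simp [pow_succ, mul_apply_eq_comp, hgen]
    simpa using this
  rw [h2] at h1
  have h3 : (finiteLaw κ Λ t x).real Set.univ = 1 := by simpa using h1
  exact ⟨by rw [← ENNReal.toReal_eq_one_iff]; exact h3⟩

end FiniteLaw

/-! ### The laws of the infinite dynamics -/

section LimitLaw

open scoped BoundedContinuousFunction ENNReal

variable {S : Type*}

/-- A Lyapunov function: under the generator of any finite dynamics it grows at most at
exponential rate one. -/
structure IsLyapunov (κ : S → Kernel (S → ℝ) (S → ℝ)) (W : (S → ℝ) → ℝ≥0∞) : Prop where
  measurable : Measurable W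
  sum_le : ∀ (Λ : Finset S) y, ∑ k ∈ Λ, ∫⁻ z, W z ∂(κ k y) ≤ (Λ.card + 1) * W y

variable {κ : S → Kernel (S → ℝ) (S → ℝ)}

theorem IsLyapunov.lintegral_finiteLaw_le {W : (S → ℝ) → ℝ≥0∞} (hW : IsLyapunov κ W)
    (Λ : Finset S) {t : ℝ} (ht : 0 ≤ t) (x : S → ℝ) :
    ∫⁻ y, W y ∂(finiteLaw κ Λ t x) ≤ ENNReal.ofReal (Real.exp t) * W x := by
  have := _root_.lintegral_finiteLaw_le (x := x) hW.measurable (c := Λ.card + 1)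
    (by simpa using hW.sum_le Λ) ht
  simpa using this

variable [Countable S]

/-- If every coordinate is dominated by a Lyapunov function which is finite at `x`, then the laws at
time `t` of the finite dynamics started at `x` are tight. -/
theorem isTightMeasureSet_finiteLaw {t : ℝ} (ht : 0 ≤ t) {x : S → ℝ}
    (hcoord : ∀ j, ∃ W, IsLyapunov κ W ∧ (∀ y, ‖y j‖ₑ ≤ W y) ∧ W x ≠ ∞) :
    IsTightMeasureSet (Set.range fun Λ => finiteLaw κ Λ t x) := by
  rw [isTightMeasureSet_iff_exists_isCompact_measure_compl_le]
  intro ε hε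
  choose W hW hle hfin using hcoord
  obtain ⟨δ, hδ, hsum⟩ := ENNReal.exists_pos_sum_of_countable hε.ne' S
  let b (j : S) : ℝ≥0∞ := ENNReal.ofReal (Real.exp t) * W j x
  have hb (j : S) : b j ≠ ∞ := ENNReal.mul_ne_top ENNReal.ofReal_ne_top (hfin j)
  let M (j : S) : ℝ≥0∞ := b j / δ j + 1
  have hδ0 (j : S) : (δ j : ℝ≥0∞) ≠ 0 := by exact_mod_cast (hδ j).ne'
  have hM (j : S) : M j ≠ ∞ := ENNReal.add_ne_top.2 ⟨ENNReal.div_ne_top (hb j) (hδ0 j), by simp⟩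
  refine ⟨Set.pi Set.univ fun j => Metric.closedBall 0 (M j).toReal,
    isCompact_univ_pi fun j => isCompact_closedBall _ _, ?_⟩
  rintro _ ⟨Λ, rfl⟩
  have hsub : (Set.pi Set.univ fun j => Metric.closedBall (0 : ℝ) (M j).toReal)ᶜ
      ⊆ ⋃ j, {y : S → ℝ | M j ≤ ‖y j‖ₑ} := by
    intro y hy
    simp only [Set.mem_compl_iff, Set.mem_univ_pi, mem_closedBall_zero_iff, not_forall,
      not_le] at hy
    obtain ⟨j, hj⟩ := hy
    refine Set.mem_iUnion.2 ⟨j, ?_⟩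
    rw [Set.mem_ofPred_eq, ← ofReal_norm, ← ENNReal.ofReal_toReal (hM j)]
    exact ENNReal.ofReal_le_ofReal hj.le
  refine (measure_mono hsub).trans ((measure_iUnion_le _).trans ?_)
  refine (ENNReal.tsum_le_tsum fun j => ?_).trans hsum.le
  refine (meas_ge_le_lintegral_div (measurable_pi_apply j).enorm.aemeasurable
    (by simp [M]) (hM j)).trans ?_
  have h1 : ∫⁻ y, ‖y j‖ₑ ∂(finiteLaw κ Λ t x) ≤ b j :=
    (lintegral_mono (hle j)).trans ((hW j).lintegral_finiteLaw_le Λ ht x)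
  refine ENNReal.div_le_of_le_mul (h1.trans ?_)
  calc b j = δ j * (b j / δ j) := (ENNReal.mul_div_cancel (hδ0 j) ENNReal.coe_ne_top).symm
    _ ≤ δ j * M j := by gcongr; exact le_self_add

variable [DecidableEq S] [∀ k, IsMarkovKernel (κ k)]
  {K : S → ((S → ℝ) →ᵇ ℝ) →L[ℝ] ((S → ℝ) →ᵇ ℝ)} {nb : S → Finset S} {m : ℕ}

/-- The law at time `t` of the infinite dynamics started at `x`, as a weak limit of the laws of the
finite dynamics. Almost surely it gives a finite value to every lower semicontinuous Lyapunov
function which is finite at `x`. -/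
theorem exists_limitLaw (h : IsLocalUpdate K dependingOn nb m)
    (hK : ∀ k f y, K k f y = ∫ z, f z ∂(κ k y)) {t : ℝ} (ht : 0 ≤ t) {x : S → ℝ}
    (hcoord : ∀ j, ∃ W, IsLyapunov κ W ∧ (∀ y, ‖y j‖ₑ ≤ W y) ∧ W x ≠ ∞) :
    ∃ Q : Measure (S → ℝ), IsProbabilityMeasure Q ∧
      (∀ f ∈ localClosure dependingOn, ∫ y, f y ∂Q = limitSemigroup K t f x) ∧
      ∀ W, IsLyapunov κ W → LowerSemicontinuous W → W x ≠ ∞ → ∀ᵐ y ∂Q, W y ≠ ∞ := by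
  let law (Λ : Finset S) : ProbabilityMeasure (S → ℝ) :=
    ⟨finiteLaw κ Λ t x, isProbabilityMeasure_finiteLaw hK ht⟩
  have hcomp : IsCompact (closure (Set.range law)) := by
    refine isCompact_closure_of_isTightMeasureSet
      ((isTightMeasureSet_finiteLaw ht hcoord).subset ?_)
    rintro _ ⟨_, ⟨Λ, rfl⟩, rfl⟩
    exact ⟨Λ, rfl⟩
  let F : Ultrafilter (Finset S) := Ultrafilter.of atTop
  have hF : (F : Filter (Finset S)) ≤ atTop := Ultrafilter.of_le _
  obtain ⟨Q, -, hQ⟩ := hcomp.ultrafilter_le_nhds (F.map law) (by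
    rw [Ultrafilter.coe_map, le_principal_iff]
    exact Filter.mem_map.2 (Eventually.of_forall fun Λ => subset_closure ⟨Λ, rfl⟩))
  have hQ : Tendsto law F (𝓝 Q) := hQ
  refine ⟨Q, inferInstance, fun f hf => ?_, fun W hW hlsc hx => ?_⟩
  · have h1 := (ProbabilityMeasure.tendsto_iff_forall_integral_tendsto.1 hQ) f
    have h2 : Tendsto (fun Λ => finiteSemigroup K Λ t f x) F (𝓝 (limitSemigroup K t f x)) :=
      ((BoundedContinuousFunction.evalCLM ℝ x).continuous.tendsto _).comp
        ((h.tendsto_limitSemigroup ht hf).mono_left hF)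
    refine tendsto_nhds_unique h1 (h2.congr fun Λ => ?_)
    exact (integral_finiteLaw hK ht f).symm
  · rw [ae_iff]
    simp only [ne_eq, not_not]
    set b : ℝ≥0∞ := ENNReal.ofReal (Real.exp t) * W x with hb
    have hb' : b ≠ ∞ := ENNReal.mul_ne_top ENNReal.ofReal_ne_top hx
    have hbound (n : ℕ) : (Q : Measure (S → ℝ)) {y | W y = ∞} ≤ b / (n + 1 : ℕ) := by
      have hopen : IsOpen {y | ((n + 1 : ℕ) : ℝ≥0∞) < W y} := hlsc.isOpen_preimage _
      refine (measure_mono fun y hy => ?_).trans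
        ((ProbabilityMeasure.le_liminf_measure_open_of_tendsto hQ hopen).trans ?_)
      · have hy : W y = ∞ := hy
        simp [hy]
      · refine (liminf_le_liminf (v := fun _ => b / (n + 1 : ℕ))
          (Eventually.of_forall fun Λ => ?_)).trans (liminf_const _).le
        refine (measure_mono (t := {y | ((n + 1 : ℕ) : ℝ≥0∞) ≤ W y}) fun y hy =>
          le_of_lt (show ((n + 1 : ℕ) : ℝ≥0∞) < W y from hy)).trans ((meas_ge_le_lintegral_div
          (ε := (n + 1 : ℕ)) hW.measurable.aemeasurable (by simp) (by simp)).trans ?_)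
        gcongr
        exact hW.lintegral_finiteLaw_le Λ ht x
    have hlim : Tendsto (fun n : ℕ => b / (n + 1 : ℕ)) atTop (𝓝 0) :=
      (ENNReal.Tendsto.const_div ENNReal.tendsto_nat_nhds_top (Or.inr hb')).comp
        (tendsto_add_atTop_nat 1) |>.trans (by simp)
    exact le_antisymm (ge_of_tendsto' hlim hbound) zero_le

end LimitLaw

/-! ### Measures are determined by local functions -/

section LocalFunctions

open scoped BoundedContinuousFunction ENNReal

variable {S : Type*}

/-- The sets on which a nonnegative local bounded continuous function is positive. -/
def localOpens (S : Type*) : Set (Set (S → ℝ)) :=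
  {s | ∃ (I : Finset S) (f : (S → ℝ) →ᵇ ℝ), f ∈ dependingOn I ∧ (∀ y, 0 ≤ f y) ∧
    s = {y | 0 < f y}}

theorem isPiSystem_localOpens : IsPiSystem (localOpens S) := by
  classical
  rintro _ ⟨I, f, hf, hf0, rfl⟩ _ ⟨J, g, hg, hg0, rfl⟩ -
  refine ⟨I ∪ J, f * g, ?_, fun y => mul_nonneg (hf0 y) (hg0 y), ?_⟩
  · intro x y hxy
    simp only [BoundedContinuousFunction.coe_mul, Pi.mul_apply]
    rw [hf fun i hi => hxy i (by simp [Finset.mem_coe.1 hi]),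
      hg fun i hi => hxy i (by simp [Finset.mem_coe.1 hi])]
  · ext y
    simp only [Set.mem_inter_iff, Set.mem_ofPred_eq, BoundedContinuousFunction.coe_mul,
      Pi.mul_apply]
    refine ⟨fun h => mul_pos h.1 h.2, fun h => ⟨?_, ?_⟩⟩
    · exact pos_of_mul_pos_left h (hg0 y)
    · exact pos_of_mul_pos_right h (hf0 y)

theorem generateFrom_localOpens [Countable S] :
    MeasurableSpace.generateFrom (localOpens S)
      = (MeasurableSpace.pi : MeasurableSpace (S → ℝ)) := by
  apply le_antisymm
  · refine MeasurableSpace.generateFrom_le ?_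
    rintro _ ⟨I, f, -, -, rfl⟩
    exact measurableSet_lt measurable_const f.continuous.measurable
  · refine iSup_le fun j => ?_
    rw [BorelSpace.measurable_eq (α := ℝ), borel_eq_generateFrom_Ioi ℝ,
      MeasurableSpace.comap_generateFrom]
    refine MeasurableSpace.generateFrom_le ?_
    rintro _ ⟨_, ⟨a, rfl⟩, rfl⟩
    refine MeasurableSpace.measurableSet_generateFrom ⟨{j},
      BoundedContinuousFunction.ofNormedAddCommGroup (fun y => max 0 (min 1 (y j - a)))
        (by fun_prop) 1 (fun y => ?_), ?_, fun y => le_max_left _ _, ?_⟩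
    · rw [Real.norm_of_nonneg (le_max_left _ _)]
      exact max_le zero_le_one (min_le_left _ _)
    · intro x y hxy
      have : x j = y j := hxy j (by simp)
      simp [this]
    · ext y
      simp

theorem tendsto_integral_min_mul {Q : Measure (S → ℝ)} [IsFiniteMeasure Q] {f : (S → ℝ) → ℝ}
    (hf : Measurable f) (hf0 : ∀ y, 0 ≤ f y) :
    Tendsto (fun n : ℕ => ∫ y, min 1 (n * f y) ∂Q) atTop (𝓝 (Q.real {y | 0 < f y})) := by
  have hs : MeasurableSet {y | 0 < f y} := measurableSet_lt measurable_const hf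
  rw [← integral_indicator_one hs]
  refine tendsto_integral_of_dominated_convergence (fun _ => 1)
    (fun n => (by fun_prop : Measurable _).aestronglyMeasurable) (integrable_const 1)
    (fun n => ae_of_all _ fun y => ?_) (ae_of_all _ fun y => ?_)
  · have : 0 ≤ (n : ℝ) * f y := mul_nonneg n.cast_nonneg (hf0 y)
    rw [Real.norm_of_nonneg (le_min zero_le_one this)]
    exact min_le_left _ _
  · rcases (hf0 y).eq_or_lt with h | h
    · simp [← h]
    · rw [Set.indicator_of_mem (by exact h)]
      refine tendsto_const_nhds.congr' ?_
      obtain ⟨N, hN⟩ := exists_nat_gt (1 / f y)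
      filter_upwards [eventually_ge_atTop N] with n hn
      have h1 : 1 / f y < n := hN.trans_le (by exact_mod_cast hn)
      rw [div_lt_iff₀ h] at h1
      exact (min_eq_left h1.le).symm

/-- The bounded continuous function `min 1 (n * f)`, for `f` nonnegative. -/
theorem exists_min_mul_mem {I : Finset S} {f : (S → ℝ) →ᵇ ℝ} (hf : f ∈ dependingOn I)
    (hf0 : ∀ y, 0 ≤ f y) (n : ℕ) : ∃ g ∈ dependingOn I, ∀ y, g y = min 1 (n * f y) := by
  refine ⟨BoundedContinuousFunction.ofNormedAddCommGroup (fun y => min 1 (n * f y))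
    (by fun_prop) 1 (fun y => ?_), fun x y hxy => ?_, fun y => rfl⟩
  · rw [Real.norm_of_nonneg (le_min zero_le_one (mul_nonneg n.cast_nonneg (hf0 y)))]
    exact min_le_left _ _
  · simp [hf hxy]

variable [Countable S]

/-- A probability measure is determined by the integrals of local functions. -/
theorem measure_ext_of_local {Q Q' : Measure (S → ℝ)} [IsProbabilityMeasure Q]
    [IsProbabilityMeasure Q']
    (h : ∀ I, ∀ f ∈ dependingOn I, ∫ y, f y ∂Q = ∫ y, f y ∂Q') : Q = Q' := by
  refine ext_of_generate_finite (localOpens S) generateFrom_localOpens.symm isPiSystem_localOpens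
    ?_ (by simp)
  rintro _ ⟨I, f, hf, hf0, rfl⟩
  rw [← measureReal_eq_measureReal_iff]
  refine tendsto_nhds_unique (tendsto_integral_min_mul f.continuous.measurable hf0) ?_
  refine (tendsto_integral_min_mul f.continuous.measurable hf0).congr fun n => ?_
  obtain ⟨g, hg, hgf⟩ := exists_min_mul_mem hf hf0 n
  simp_rw [← hgf]
  exact (h I g hg).symm

theorem measurable_of_local {Y : Type*} [MeasurableSpace Y] {Q : Y → Measure (S → ℝ)}
    [∀ x, IsProbabilityMeasure (Q x)]
    (h : ∀ I, ∀ f ∈ dependingOn I, Measurable fun x => ∫ y, f y ∂(Q x)) : Measurable Q := by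
  refine Measurable.measure_of_isPiSystem_of_isProbabilityMeasure generateFrom_localOpens.symm
    isPiSystem_localOpens ?_
  rintro _ ⟨I, f, hf, hf0, rfl⟩
  have h1 : Measurable fun x => (Q x).real {y | 0 < f y} := by
    refine measurable_of_tendsto_metrizable (f := fun (n : ℕ) x => ∫ y, min 1 (n * f y) ∂(Q x))
      (fun n => ?_)
      (tendsto_pi_nhds.2 fun x => tendsto_integral_min_mul f.continuous.measurable hf0)
    obtain ⟨g, hg, hgf⟩ := exists_min_mul_mem hf hf0 n
    simp_rw [← hgf]
    exact h I g hg
  simpa using h1.ennreal_ofReal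

end LocalFunctions

/-! ### The transition function -/

section TransitionFunction

open scoped BoundedContinuousFunction ENNReal

variable {S : Type*} [DecidableEq S]
  {K : S → ((S → ℝ) →ᵇ ℝ) →L[ℝ] ((S → ℝ) →ᵇ ℝ)} {nb : S → Finset S} {m : ℕ}

/-- If the limiting semigroup, started in the measurable set `X`, is given by probability measures
that live on `X`, then these form a transition function on `X`. -/
theorem exists_transitionFunction [Countable S] (h : IsLocalUpdate K dependingOn nb m)
    {X : Set (S → ℝ)} (hX : MeasurableSet X)
    (hQ : ∀ (t : ℝ≥0) (x : X), ∃ Q : Measure (S → ℝ), IsProbabilityMeasure Q ∧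
      (∀ f ∈ localClosure dependingOn, ∫ y, f y ∂Q = limitSemigroup K t f x) ∧
      ∀ᵐ y ∂Q, y ∈ X) :
    ∃ P : ℝ≥0 → Kernel X X, Harness.IsTransitionFunction P ∧
      ∀ t, ∀ f ∈ localClosure dependingOn, ∀ x : X,
        ∫ y, f y ∂(P t x) = limitSemigroup K t f x := by
  choose Q hprob hint hae using hQ
  have hmeas (t : ℝ≥0) : Measurable (Q t) := by
    refine measurable_of_local fun I f hf => ?_
    simp_rw [hint t _ f (mem_localClosure hf)]
    exact (limitSemigroup K t f).continuous.measurable.comp measurable_subtype_coe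
  have hemb : MeasurableEmbedding ((↑) : X → S → ℝ) := MeasurableEmbedding.subtype_coe hX
  let P (t : ℝ≥0) : Kernel X X := Kernel.comapRight ⟨Q t, hmeas t⟩ hemb
  have hP (t : ℝ≥0) (x : X) : P t x = (Q t x).comap (↑) := Kernel.comapRight_apply _ hemb x
  have hmarkov (t : ℝ≥0) : IsMarkovKernel (P t) := by
    refine Kernel.IsMarkovKernel.comapRight _ hemb fun x => ?_
    rw [Subtype.range_coe]
    exact (prob_compl_eq_zero_iff hX).1 (hae t x)
  have hPint (t : ℝ≥0) (f) (hf : f ∈ localClosure dependingOn) (x : X) :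
      ∫ y, f y ∂(P t x) = limitSemigroup K t f x := by
    rw [hP, integral_subtype_comap hX (fun y : S → ℝ => f y), ← hint t x f hf,
      Measure.restrict_eq_self_of_ae_mem (hae t x)]
  -- laws on `X` are determined by the integrals of local functions
  have hext {μ μ' : Measure X} [IsProbabilityMeasure μ] [IsProbabilityMeasure μ']
      (hμ : ∀ I : Finset S, ∀ f ∈ dependingOn I, ∫ y : X, f y ∂μ = ∫ y : X, f y ∂μ') : μ = μ' := by
    have := Measure.isProbabilityMeasure_map (μ := μ) hemb.measurable.aemeasurable
    have := Measure.isProbabilityMeasure_map (μ := μ') hemb.measurable.aemeasurable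
    have h1 : μ.map ((↑) : X → S → ℝ) = μ'.map (↑) := by
      refine measure_ext_of_local fun I f hf => ?_
      rw [hemb.integral_map, hemb.integral_map]
      exact hμ I f hf
    rw [← hemb.comap_map μ, h1, hemb.comap_map]
  refine ⟨P, ⟨hmarkov, ?_, fun s t => ?_⟩, hPint⟩
  · ext1 x
    refine hext fun I f hf => ?_
    rw [hPint 0 f (mem_localClosure hf), NNReal.coe_zero, h.limitSemigroup_zero
      (mem_localClosure hf), Kernel.id_apply, integral_dirac' (fun y : X => f y) _
      (f.continuous.measurable.comp measurable_subtype_coe).stronglyMeasurable]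
  · ext1 x
    refine hext fun I f hf => ?_
    have hf' := mem_localClosure hf
    have hfi : Integrable (fun y : X => f y) ((P t ∘ₖ P s) x) :=
      Integrable.of_bound (f.continuous.measurable.comp measurable_subtype_coe).aestronglyMeasurable
        ‖f‖ (ae_of_all _ fun y => f.norm_coe_le_norm y)
    rw [hPint _ f hf', Kernel.integral_comp hfi, NNReal.coe_add,
      h.limitSemigroup_add s.coe_nonneg t.coe_nonneg hf']
    simp_rw [hPint t f hf']
    exact (hPint s _ (h.limitSemigroup_mem t.coe_nonneg hf') x).symm

/-- The derivative of the semigroup at time zero, on local functions. -/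
theorem IsLocalUpdate.tendsto_limitSemigroup_sub_div (h : IsLocalUpdate K dependingOn nb m)
    {I : Finset S} {f : (S → ℝ) →ᵇ ℝ} (hf : f ∈ dependingOn I) (x : S → ℝ) :
    Tendsto (fun u : ℝ≥0 => (u : ℝ)⁻¹ * (limitSemigroup K u f x - f x)) (𝓝[>] 0)
      (𝓝 (finiteGenerator K I f x)) := by
  set C : ℝ := 2 * (4 * m) ^ 2 * (2 ^ I.card * ‖f‖) with hC
  have hu0 : Tendsto (fun u : ℝ≥0 => (u : ℝ)) (𝓝[>] 0) (𝓝 0) := by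
    have : Tendsto (fun u : ℝ≥0 => (u : ℝ)) (𝓝 0) (𝓝 ((0 : ℝ≥0) : ℝ)) :=
      NNReal.continuous_coe.tendsto 0
    exact this.mono_left nhdsWithin_le_nhds
  have hsmall : ∀ᶠ u : ℝ≥0 in 𝓝[>] 0, 8 * m * (u : ℝ) ≤ 1 := by
    have : Tendsto (fun u : ℝ≥0 => 8 * m * (u : ℝ)) (𝓝[>] 0) (𝓝 0) := by
      simpa using hu0.const_mul (8 * m : ℝ)
    exact this.eventually (Iic_mem_nhds one_pos)
  rw [tendsto_iff_norm_sub_tendsto_zero]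
  refine squeeze_zero' (Eventually.of_forall fun _ => norm_nonneg _) ?_
    (show Tendsto (fun u : ℝ≥0 => C * (u : ℝ)) (𝓝[>] 0) (𝓝 0) by simpa using hu0.const_mul C)
  filter_upwards [hsmall, self_mem_nhdsWithin] with u hu hpos
  have hpos : (0 : ℝ) < u := hpos
  have h1 := h.norm_limitSemigroup_sub_le hpos.le hu hf
  have h2 := (BoundedContinuousFunction.norm_coe_le_norm
    (limitSemigroup K u f - f - (u : ℝ) • finiteGenerator K I f) x).trans h1
  have h3 : (u : ℝ)⁻¹ * (limitSemigroup K u f x - f x) - finiteGenerator K I f x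
      = (u : ℝ)⁻¹ * (limitSemigroup K u f - f - (u : ℝ) • finiteGenerator K I f) x := by
    simp only [BoundedContinuousFunction.coe_sub, BoundedContinuousFunction.coe_smul,
      Pi.sub_apply, smul_eq_mul]
    field_simp
  rw [h3, norm_mul, norm_inv, Real.norm_of_nonneg hpos.le, inv_mul_le_iff₀ hpos]
  exact h2.trans (le_of_eq (by rw [hC]; ring))

end TransitionFunction

/-! ### Norms on the lattice -/

namespace Harness

open scoped BoundedContinuousFunction ENNReal

variable {d : ℕ} {N : Seminorm ℝ (Fin d → ℝ)}

/-- All norms on `ℝ^d` are equivalent; this is the bound from below by the sup norm. -/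
theorem exists_mul_norm_le (hN : ∀ v, N v = 0 → v = 0) : ∃ c > 0, ∀ v, c * ‖v‖ ≤ N v := by
  have hcont : ContinuousOn N Set.univ := N.convexOn.continuousOn isOpen_univ
  rcases (Metric.sphere (0 : Fin d → ℝ) 1).eq_empty_or_nonempty with h | h
  · refine ⟨1, one_pos, fun v => ?_⟩
    have : v = 0 := by
      by_contra hv
      have : (‖v‖⁻¹ • v) ∈ Metric.sphere (0 : Fin d → ℝ) 1 := by
        simp [norm_smul, hv]
      simp [h] at this
    simp [this]
  · obtain ⟨v₀, hv₀, hmin⟩ :=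
      (isCompact_sphere (0 : Fin d → ℝ) 1).exists_isMinOn h (hcont.mono (Set.subset_univ _))
    have hv₀' : v₀ ≠ 0 := by
      rintro rfl
      simp at hv₀
    refine ⟨N v₀, lt_of_le_of_ne (apply_nonneg N v₀) fun h => hv₀' (hN _ h.symm), fun v => ?_⟩
    rcases eq_or_ne v 0 with rfl | hv
    · simp
    have h1 : N v₀ ≤ N (‖v‖⁻¹ • v) := hmin (by simp [norm_smul, hv])
    rw [map_smul_eq_mul, norm_inv, norm_norm, ← div_eq_inv_mul,
      le_div_iff₀ (norm_pos_iff.2 hv)] at h1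
    exact h1

theorem siteNorm_nonneg (j : Site d) : 0 ≤ siteNorm N j := apply_nonneg N _

theorem siteNorm_zero : siteNorm N (0 : Site d) = 0 := by
  have : (fun a : Fin d => (((0 : Site d) a : ℤ) : ℝ)) = 0 := by ext; simp
  rw [siteNorm, this, map_zero]

theorem siteNorm_add_le (i j : Site d) : siteNorm N (i + j) ≤ siteNorm N i + siteNorm N j := by
  have : (fun a : Fin d => (((i + j) a : ℤ) : ℝ)) = (fun a => (i a : ℝ)) + fun a => (j a : ℝ) := by
    ext; simp
  rw [siteNorm, this]
  exact map_add_le_add N _ _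

theorem siteNorm_neg (j : Site d) : siteNorm N (-j) = siteNorm N j := by
  have : (fun a : Fin d => (((-j) a : ℤ) : ℝ)) = -fun a => (j a : ℝ) := by ext; simp
  rw [siteNorm, this, map_neg_eq_map]
  rfl

theorem siteNorm_pos (hN : ∀ v, N v = 0 → v = 0) {j : Site d} (hj : j ≠ 0) :
    0 < siteNorm N j := by
  refine lt_of_le_of_ne (siteNorm_nonneg j) fun h => hj ?_
  have := hN _ h.symm
  ext a
  simpa using congrFun this a

theorem exists_mul_abs_le (hN : ∀ v, N v = 0 → v = 0) :
    ∃ c > 0, ∀ (j : Site d) (a : Fin d), c * |(j a : ℝ)| ≤ siteNorm N j := by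
  obtain ⟨c, hc, h⟩ := exists_mul_norm_le hN
  refine ⟨c, hc, fun j a => (mul_le_mul_of_nonneg_left ?_ hc.le).trans (h _)⟩
  exact norm_le_pi_norm (fun a => (j a : ℝ)) a

theorem finite_siteNorm_lt (hN : ∀ v, N v = 0 → v = 0) (R : ℝ) :
    {j : Site d | siteNorm N j < R}.Finite := by
  obtain ⟨c, hc, h⟩ := exists_mul_abs_le hN
  refine (Set.finite_Icc (fun _ : Fin d => -⌈R / c⌉) fun _ => ⌈R / c⌉).subset fun j hj => ?_
  have hj : siteNorm N j < R := hj
  have h1 (a : Fin d) : |j a| ≤ ⌈R / c⌉ := by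
    have h2 : |(j a : ℝ)| ≤ R / c := by
      rw [le_div_iff₀ hc, mul_comm]
      exact (h j a).trans hj.le
    have h3 := h2.trans (Int.le_ceil (R / c))
    exact_mod_cast h3
  exact ⟨fun a => (abs_le.1 (h1 a)).1, fun a => (abs_le.1 (h1 a)).2⟩

theorem summable_pow_natAbs {r : ℝ} (hr0 : 0 ≤ r) (hr1 : r < 1) :
    Summable fun j : ℤ => r ^ j.natAbs := by
  refine Summable.of_nat_of_neg ?_ ?_ <;> simpa using summable_geometric_of_lt_one hr0 hr1

/-- Exponentials of a norm are summable over the lattice. -/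
theorem summable_rpow_siteNorm (hN : ∀ v, N v = 0 → v = 0) {R α : ℝ} (hR : 0 < R)
    (hα0 : 0 ≤ α) (hα1 : α < 1) : Summable fun j : Site d => α ^ (siteNorm N j / R) := by
  classical
  rcases hα0.eq_or_lt with rfl | hα
  · refine summable_of_ne_finset_zero (s := {0}) fun j hj => ?_
    have hj : j ≠ 0 := by simpa using hj
    exact Real.zero_rpow (div_pos (siteNorm_pos hN hj) hR).ne'
  obtain ⟨c, hc, h⟩ := exists_mul_abs_le hN
  rcases Nat.eq_zero_or_pos d with rfl | hd
  · exact Summable.of_finite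
  have hd' : (0 : ℝ) < d := by exact_mod_cast hd
  set r : ℝ := α ^ (c / (d * R)) with hr
  have hr0 : 0 < r := Real.rpow_pos_of_pos hα _
  have hr1 : r < 1 := Real.rpow_lt_one hα.le hα1 (by positivity)
  have hle (j : Site d) : α ^ (siteNorm N j / R) ≤ ∏ a, r ^ (j a).natAbs := by
    have h1 : c / (d * R) * ∑ a, |(j a : ℝ)| ≤ siteNorm N j / R := by
      have h2 : ∑ a : Fin d, c * |(j a : ℝ)| ≤ ∑ _a : Fin d, siteNorm N j :=
        Finset.sum_le_sum fun a _ => h j a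
      rw [← Finset.mul_sum, Finset.sum_const, Finset.card_univ, Fintype.card_fin,
        nsmul_eq_mul] at h2
      rw [div_mul_eq_mul_div, div_le_div_iff₀ (by positivity) hR]
      nlinarith
    refine (Real.rpow_le_rpow_of_exponent_ge hα hα1.le h1).trans (le_of_eq ?_)
    rw [Real.rpow_mul hα.le, ← hr, Finset.prod_pow_eq_pow_sum, ← Real.rpow_natCast]
    push_cast
    congr 1
    exact Finset.sum_congr rfl fun a _ => by simp [Nat.cast_natAbs]
  have hsum := summable_pow_natAbs hr0.le hr1
  refine Summable.of_nonneg_of_le (fun j => Real.rpow_nonneg hα.le _) hle ?_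
  refine summable_of_sum_le (c := (∑' i : ℤ, r ^ i.natAbs) ^ d)
    (fun j => Finset.prod_nonneg fun a _ => by positivity) fun u => ?_
  -- enclose the finite set `u` in a box
  calc ∑ j ∈ u, ∏ a, r ^ (j a).natAbs
      ≤ ∑ j ∈ Fintype.piFinset fun a => u.image fun j => j a, ∏ a, r ^ (j a).natAbs := by
        refine Finset.sum_le_sum_of_subset_of_nonneg (fun j hj => ?_) fun j _ _ => by positivity
        exact Fintype.mem_piFinset.2 fun a => Finset.mem_image_of_mem _ hj
    _ = ∏ a, ∑ i ∈ u.image fun j => j a, r ^ i.natAbs :=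
        (Finset.prod_univ_sum (fun a => u.image fun j => j a) fun _ i => r ^ i.natAbs).symm
    _ ≤ ∏ _a : Fin d, ∑' i : ℤ, r ^ i.natAbs := by
        refine Finset.prod_le_prod (fun a _ => Finset.sum_nonneg fun i _ => by positivity)
          fun a _ => ?_
        exact hsum.sum_le_tsum _ fun i _ => by positivity
    _ = _ := by simp

end Harness

/-! ### The heat bath updates -/

namespace Harness

open scoped BoundedContinuousFunction ENNReal

variable {d : ℕ} {N : Seminorm ℝ (Fin d → ℝ)} {R α : ℝ} {p : Site d → Site d → ℝ} {D : Config d}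
  {nb : Site d → Finset (Site d)}

theorem IsHarnessMatrix.eq_sub (hp : IsHarnessMatrix N R p) (k i : Site d) :
    p k i = p 0 (i - k) := by
  rw [← hp.homogeneous k (i - k), add_sub_cancel]

/-- The interaction has finite range, with the same number of neighbours at every site. -/
theorem IsHarnessMatrix.exists_neighbours (hp : IsHarnessMatrix N R p)
    (hN : ∀ v, N v = 0 → v = 0) :
    ∃ (nb : Site d → Finset (Site d)) (m : ℕ), 1 ≤ m ∧ (∀ k, (nb k).card ≤ m) ∧
      ∀ k i, p k i ≠ 0 → i ∈ nb k := by
  classical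
  let A : Finset (Site d) := (finite_siteNorm_lt hN R).toFinset
  refine ⟨fun k => A.image (k + ·), A.card + 1, by omega,
    fun k => Finset.card_image_le.trans (Nat.le_succ _), fun k i hi => ?_⟩
  rw [hp.eq_sub] at hi
  refine Finset.mem_image.2 ⟨i - k, ?_, add_sub_cancel _ _⟩
  simp only [A, Set.Finite.mem_toFinset, Set.mem_ofPred_eq]
  by_contra h
  exact hi (hp.finite_range _ (not_lt.1 h))

theorem tsum_mul_eq_sum (hnb : ∀ k i, p k i ≠ 0 → i ∈ nb k) (k : Site d) (x : Config d) :
    ∑' i, p k i * x i = ∑ i ∈ nb k, p k i * x i :=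
  tsum_eq_sum fun i hi => by
    rw [not_not.1 (mt (hnb k i) hi), zero_mul]

theorem continuous_heatBath (hnb : ∀ k i, p k i ≠ 0 → i ∈ nb k) (k : Site d) :
    Continuous fun z : Config d × ℝ => heatBath p α D k z.1 z.2 := by
  simp_rw [heatBath, tsum_mul_eq_sum hnb]
  refine Continuous.update continuous_fst k ?_
  fun_prop

/-- The law of the configuration after an update at `k`. -/
noncomputable def heatBathKernel (p : Site d → Site d → ℝ) (α : ℝ) (D : Config d) (k : Site d) :
    Kernel (Config d) (Config d) :=
  (Kernel.id ×ₖ Kernel.const _ (gaussianReal 0 1)).map fun z => heatBath p α D k z.1 z.2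

theorem heatBathKernel_apply (hnb : ∀ k i, p k i ≠ 0 → i ∈ nb k) (k : Site d) (x : Config d) :
    heatBathKernel p α D k x = (gaussianReal 0 1).map (heatBath p α D k x) := by
  have hm := (continuous_heatBath (α := α) (D := D) hnb k).measurable
  rw [heatBathKernel, Kernel.map_apply _ hm, Kernel.prod_apply, Kernel.id_apply,
    Kernel.const_apply, Measure.dirac_prod, Measure.map_map hm measurable_prodMk_left]
  rfl

theorem isMarkovKernel_heatBathKernel (hnb : ∀ k i, p k i ≠ 0 → i ∈ nb k) (k : Site d) :
    IsMarkovKernel (heatBathKernel p α D k) :=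
  Kernel.IsMarkovKernel.map _ (continuous_heatBath hnb k).measurable

theorem continuous_integral_heatBath (hnb : ∀ k i, p k i ≠ 0 → i ∈ nb k) (k : Site d)
    (f : Config d →ᵇ ℝ) :
    Continuous fun x => ∫ g, f (heatBath p α D k x g) ∂(gaussianReal 0 1) := by
  have hc := continuous_heatBath (α := α) (D := D) hnb k
  refine continuous_of_dominated (bound := fun _ => ‖f‖) (fun x => ?_)
    (fun x => Eventually.of_forall fun g => f.norm_coe_le_norm _) (integrable_const _)
    (Eventually.of_forall fun g => ?_)
  · exact (f.continuous.comp
      (hc.comp (Continuous.prodMk_right x))).aestronglyMeasurable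
  · exact f.continuous.comp (hc.comp (Continuous.prodMk_left g))

theorem integrable_heatBath (hnb : ∀ k i, p k i ≠ 0 → i ∈ nb k) (k : Site d)
    (f : Config d →ᵇ ℝ) (x : Config d) :
    Integrable (fun g => f (heatBath p α D k x g)) (gaussianReal 0 1) :=
  Integrable.of_bound (f.continuous.comp ((continuous_heatBath hnb k).comp
    (Continuous.prodMk_right x))).aestronglyMeasurable ‖f‖
    (Eventually.of_forall fun _ => f.norm_coe_le_norm _)

theorem norm_integral_heatBath_le (k : Site d) (f : Config d →ᵇ ℝ) (x : Config d) :
    ‖∫ g, f (heatBath p α D k x g) ∂(gaussianReal 0 1)‖ ≤ ‖f‖ := by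
  have := norm_integral_le_of_norm_le_const (μ := gaussianReal 0 1) (C := ‖f‖)
    (f := fun g => f (heatBath p α D k x g))
    (Eventually.of_forall fun _ => f.norm_coe_le_norm _)
  simpa using this

/-- The operator on bounded continuous functions which takes the mean over an update at `k`. -/
noncomputable def heatBathOperator (α : ℝ) (D : Config d)
    (hnb : ∀ k i, p k i ≠ 0 → i ∈ nb k) (k : Site d) :
    (Config d →ᵇ ℝ) →L[ℝ] (Config d →ᵇ ℝ) :=
  LinearMap.mkContinuous
    { toFun := fun f => BoundedContinuousFunction.ofNormedAddCommGroup _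
        (continuous_integral_heatBath (α := α) (D := D) hnb k f) ‖f‖
        (norm_integral_heatBath_le k f)
      map_add' := fun f g => by
        ext x
        exact integral_add (integrable_heatBath hnb k f x) (integrable_heatBath hnb k g x)
      map_smul' := fun c f => by
        ext x
        exact integral_const_mul c _ }
    1 fun f => by
      rw [one_mul]
      exact BoundedContinuousFunction.norm_ofNormedAddCommGroup_le _ (norm_nonneg _)
        (norm_integral_heatBath_le k f)

theorem heatBathOperator_apply (hnb : ∀ k i, p k i ≠ 0 → i ∈ nb k) (k : Site d)
    (f : Config d →ᵇ ℝ) (x : Config d) :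
    heatBathOperator α D hnb k f x = ∫ g, f (heatBath p α D k x g) ∂(gaussianReal 0 1) := rfl

theorem heatBathOperator_apply_eq_integral (hnb : ∀ k i, p k i ≠ 0 → i ∈ nb k) (k : Site d)
    (f : Config d →ᵇ ℝ) (x : Config d) :
    heatBathOperator α D hnb k f x = ∫ z, f z ∂(heatBathKernel p α D k x) := by
  rw [heatBathKernel_apply hnb, integral_map, heatBathOperator_apply]
  · exact ((continuous_heatBath hnb k).comp (Continuous.prodMk_right x)).aemeasurable
  · exact f.continuous.aestronglyMeasurable

theorem heatBath_dependsOn {f : Config d → ℝ} {I : Finset (Site d)}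
    (hf : DependsOn f (I : Set (Site d))) {k : Site d} (hk : k ∉ I) (x : Config d) (g : ℝ) :
    f (heatBath p α D k x g) = f x :=
  hf fun _ hi => Function.update_of_ne (ne_of_mem_of_not_mem hi hk) _ _

theorem isLocalUpdate_heatBathOperator {m : ℕ} (hm : 1 ≤ m) (hcard : ∀ k, (nb k).card ≤ m)
    (hnb : ∀ k i, p k i ≠ 0 → i ∈ nb k) :
    IsLocalUpdate (heatBathOperator α D hnb) dependingOn nb m where
  one_le := hm
  card_le := hcard
  mono := fun I J hIJ f hf x y h => hf fun i hi => h i (hIJ hi)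
  norm_le := fun k f => by
    refine (BoundedContinuousFunction.norm_le (norm_nonneg f)).2 fun x => ?_
    exact norm_integral_heatBath_le k f x
  eq_self := fun {I k f} hf hk => by
    ext x
    rw [heatBathOperator_apply]
    simp_rw [heatBath_dependsOn hf hk]
    simp
  mem := fun {I k f} hf x y h => by
    rw [heatBathOperator_apply, heatBathOperator_apply]
    refine integral_congr_ae (Eventually.of_forall fun g => hf fun i hi => ?_)
    have hsum : ∑ j ∈ nb k, p k j * x j = ∑ j ∈ nb k, p k j * y j :=
      Finset.sum_congr rfl fun j hj => by
        rw [h j (by simp [hj])]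
    rw [heatBath, heatBath, tsum_mul_eq_sum hnb, tsum_mul_eq_sum hnb, hsum]
    rcases eq_or_ne i k with rfl | hik
    · simp
    · rw [Function.update_of_ne hik, Function.update_of_ne hik]
      exact h i (by simp only [Finset.coe_union]; exact Or.inl hi)

/-- On a function of the coordinates in `I`, the generator only updates the sites in `I`. -/
theorem generator_eq_finiteGenerator (hnb : ∀ k i, p k i ≠ 0 → i ∈ nb k)
    {I : Finset (Site d)} {f : Config d →ᵇ ℝ} (hf : f ∈ dependingOn I) (x : Config d) :
    generator p α D f x = finiteGenerator (heatBathOperator α D hnb) I f x := by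
  have hI := mem_dependingOn.1 hf
  have h0 (k : Site d) (hk : k ∉ I) : siteGenerator p α D k f x = 0 := by
    simp [siteGenerator, heatBath_dependsOn hI hk]
  rw [generator, tsum_eq_sum h0, finiteGenerator_apply, BoundedContinuousFunction.coe_sum,
    Finset.sum_apply]
  refine Finset.sum_congr rfl fun k _ => ?_
  rw [siteGenerator, integral_sub (integrable_heatBath hnb k f x) (integrable_const _)]
  simp [heatBathOperator_apply]

end Harness

/-! ### Weighted first moments -/

namespace Harness

open scoped BoundedContinuousFunction ENNReal

variable {d : ℕ} {N : Seminorm ℝ (Fin d → ℝ)} {R α : ℝ} {p : Site d → Site d → ℝ} {D : Config d}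
  {nb : Site d → Finset (Site d)}

/-- The first absolute moment of a standard Gaussian variable. -/
noncomputable def gaussianMoment : ℝ≥0∞ := ∫⁻ g, ‖g‖ₑ ∂(gaussianReal 0 1)

theorem gaussianMoment_ne_top : gaussianMoment ≠ ∞ := by
  have h : Integrable (fun x : ℝ => x) (gaussianReal 0 1) :=
    (memLp_id_gaussianReal 1).integrable le_rfl
  exact h.2.ne

/-- The weighted sum of heights, plus a constant that pays for the data and for the noise. -/
noncomputable def weightedSum (α : ℝ) (D : Config d) (v : Site d → ℝ≥0∞) (y : Config d) : ℝ≥0∞ :=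
  ∑' i, v i * ‖y i‖ₑ + ∑' k, v k * (ENNReal.ofReal (1 - α) * ‖D k‖ₑ + gaussianMoment)

theorem enorm_heatBath_le (hp : IsHarnessMatrix N R p) (hα0 : 0 ≤ α) (hα1 : α < 1)
    (hnb : ∀ k i, p k i ≠ 0 → i ∈ nb k) (k : Site d) (y : Config d) (g : ℝ) :
    ‖α * (∑' i, p k i * y i) + (1 - α) * D k + g‖ₑ ≤
      ENNReal.ofReal α * ∑' i, ENNReal.ofReal (p k i) * ‖y i‖ₑ +
        ENNReal.ofReal (1 - α) * ‖D k‖ₑ + ‖g‖ₑ := by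
  refine (enorm_add_le _ _).trans (add_le_add_left ((enorm_add_le _ _).trans ?_) _)
  rw [enorm_mul, enorm_mul, Real.enorm_of_nonneg hα0, Real.enorm_of_nonneg (sub_pos.2 hα1).le]
  gcongr
  rw [tsum_mul_eq_sum hnb]
  refine (enorm_sum_le _ _).trans ?_
  refine le_trans (Finset.sum_le_sum fun i _ => ?_) (ENNReal.sum_le_tsum (nb k))
  rw [enorm_mul, Real.enorm_of_nonneg (hp.nonneg k i)]

theorem tsum_update_le (v : Site d → ℝ≥0∞) (y : Config d) (k : Site d) (h : ℝ) :
    ∑' i, v i * ‖Function.update y k h i‖ₑ ≤ ∑' i, v i * ‖y i‖ₑ + v k * ‖h‖ₑ := by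
  rw [← tsum_ite_eq k fun i => v i * ‖h‖ₑ, ← ENNReal.tsum_add]
  refine ENNReal.tsum_le_tsum fun i => ?_
  rcases eq_or_ne i k with rfl | hi
  · simp
  · simp [hi]

theorem measurable_weightedSum (v : Site d → ℝ≥0∞) : Measurable (weightedSum α D v) := by
  unfold weightedSum
  fun_prop

theorem lowerSemicontinuous_weightedSum {v : Site d → ℝ≥0∞} (hv : ∀ i, v i ≠ ∞) :
    LowerSemicontinuous (weightedSum α D v) := by
  refine LowerSemicontinuous.add ?_ lowerSemicontinuous_const
  refine lowerSemicontinuous_tsum fun i => Continuous.lowerSemicontinuous ?_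
  exact (ENNReal.continuous_const_mul (hv i)).comp (continuous_apply i).enorm

/-- If the weights are excessive for the matrix `α p`, then the update at `k` increases the weighted
sum at most by the weight of `k` times the new height, and summation over `k` gives back the
weighted sum. -/
theorem isLyapunov_weightedSum (hp : IsHarnessMatrix N R p) (hα0 : 0 ≤ α) (hα1 : α < 1)
    (hnb : ∀ k i, p k i ≠ 0 → i ∈ nb k) {v : Site d → ℝ≥0∞}
    (hv : ∀ i, ENNReal.ofReal α * ∑' k, ENNReal.ofReal (p k i) * v k ≤ v i) :
    IsLyapunov (heatBathKernel p α D) (weightedSum α D v) where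
  measurable := measurable_weightedSum v
  sum_le Λ y := by
    set a : Site d → ℝ≥0∞ := fun k => ENNReal.ofReal α * ∑' i, ENNReal.ofReal (p k i) * ‖y i‖ₑ
    set c : Site d → ℝ≥0∞ := fun k => ENNReal.ofReal (1 - α) * ‖D k‖ₑ
    have h1 (k : Site d) : ∫⁻ z, weightedSum α D v z ∂(heatBathKernel p α D k y) ≤
        weightedSum α D v y + v k * (a k + (c k + gaussianMoment)) := by
      have hm : Measurable (heatBath p α D k y) :=
        ((continuous_heatBath hnb k).comp (Continuous.prodMk_right y)).measurable
      rw [heatBathKernel_apply hnb, lintegral_map (measurable_weightedSum v) hm]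
      calc ∫⁻ g, weightedSum α D v (heatBath p α D k y g) ∂(gaussianReal 0 1)
          ≤ ∫⁻ g, (weightedSum α D v y + v k * (a k + c k + ‖g‖ₑ)) ∂(gaussianReal 0 1) := by
            refine lintegral_mono fun g => ?_
            rw [weightedSum, weightedSum, add_right_comm]
            gcongr
            refine (tsum_update_le v y k _).trans ?_
            gcongr
            exact enorm_heatBath_le hp hα0 hα1 hnb k y g
        _ = _ := by
            rw [lintegral_add_left measurable_const, lintegral_const_mul _ (by fun_prop),
              lintegral_add_left measurable_const, lintegral_const, lintegral_const,
              measure_univ, mul_one, mul_one, ← gaussianMoment, add_assoc (a k)]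
    have h2 : ∑' k, v k * a k ≤ ∑' i, v i * ‖y i‖ₑ := by
      calc ∑' k, v k * a k
          = ∑' k, ∑' i, ENNReal.ofReal α * (ENNReal.ofReal (p k i) * v k) * ‖y i‖ₑ := by
            refine tsum_congr fun k => ?_
            simp only [a]
            rw [← ENNReal.tsum_mul_left, ← ENNReal.tsum_mul_left]
            exact tsum_congr fun i => by ring
        _ = ∑' i, (ENNReal.ofReal α * ∑' k, ENNReal.ofReal (p k i) * v k) * ‖y i‖ₑ := by
            rw [ENNReal.tsum_comm]
            refine tsum_congr fun i => ?_
            rw [ENNReal.tsum_mul_right, ENNReal.tsum_mul_left]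
        _ ≤ _ := ENNReal.tsum_le_tsum fun i => mul_le_mul_left (hv i) _
    calc ∑ k ∈ Λ, ∫⁻ z, weightedSum α D v z ∂(heatBathKernel p α D k y)
        ≤ ∑ k ∈ Λ, (weightedSum α D v y + v k * (a k + (c k + gaussianMoment))) :=
          Finset.sum_le_sum fun k _ => h1 k
      _ = Λ.card * weightedSum α D v y + ∑ k ∈ Λ, v k * (a k + (c k + gaussianMoment)) := by
          rw [Finset.sum_add_distrib, Finset.sum_const, nsmul_eq_mul]
      _ ≤ Λ.card * weightedSum α D v y + ∑' k, v k * (a k + (c k + gaussianMoment)) := by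
          gcongr
          exact ENNReal.sum_le_tsum _
      _ ≤ Λ.card * weightedSum α D v y + weightedSum α D v y := by
          gcongr
          simp_rw [mul_add (v _) (a _)]
          rw [ENNReal.tsum_add, weightedSum]
          gcongr
      _ = _ := by rw [add_mul, one_mul]

/-- The weights which decay exponentially in the distance from `j`. -/
noncomputable def weight (N : Seminorm ℝ (Fin d → ℝ)) (R α : ℝ) (j k : Site d) : ℝ≥0∞ :=
  ENNReal.ofReal (α ^ (siteNorm N (k - j) / R))

theorem weight_self (j : Site d) : weight N R α j j = 1 := by
  simp [weight, siteNorm_zero]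

/-- The exponential weights are excessive, since they change at most by the factor `α` within the
range of the matrix. -/
theorem mul_tsum_weight_le (hp : IsHarnessMatrix N R p) (hR : 0 < R) (hα0 : 0 ≤ α) (hα1 : α < 1)
    (j i : Site d) :
    ENNReal.ofReal α * ∑' k, ENNReal.ofReal (p k i) * weight N R α j k ≤ weight N R α j i := by
  have h1 (k : Site d) : ENNReal.ofReal α * (ENNReal.ofReal (p k i) * weight N R α j k) ≤
      ENNReal.ofReal (p i k) * weight N R α j i := by
    rw [hp.symmetric k i, mul_left_comm]
    rcases eq_or_ne (p i k) 0 with h0 | h0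
    · simp [h0]
    gcongr
    rw [weight, weight, ← ENNReal.ofReal_mul hα0]
    refine ENNReal.ofReal_le_ofReal ?_
    have hk : 0 ≤ siteNorm N (k - j) / R := div_nonneg (siteNorm_nonneg _) hR.le
    have hi : 0 ≤ siteNorm N (i - j) / R := div_nonneg (siteNorm_nonneg _) hR.le
    have hlt : siteNorm N (k - i) < R := by
      by_contra h
      rw [hp.eq_sub] at h0
      exact h0 (hp.finite_range _ (not_lt.1 h))
    have hle : siteNorm N (i - j) / R ≤ 1 + siteNorm N (k - j) / R := by
      rw [← div_self hR.ne', ← add_div]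
      refine div_le_div_of_nonneg_right ?_ hR.le
      have h2 := siteNorm_add_le (N := N) (i - k) (k - j)
      rw [sub_add_sub_cancel, ← neg_sub k i, siteNorm_neg] at h2
      linarith
    calc α * α ^ (siteNorm N (k - j) / R) = α ^ (1 + siteNorm N (k - j) / R) := by
          rw [Real.rpow_add_of_nonneg hα0 zero_le_one hk, Real.rpow_one]
      _ ≤ _ := Real.rpow_le_rpow_of_exponent_ge' hα0 hα1.le hi hle
  rw [← ENNReal.tsum_mul_left]
  refine (ENNReal.tsum_le_tsum h1).trans ?_
  rw [ENNReal.tsum_mul_right, ← ENNReal.ofReal_tsum_of_nonneg (hp.nonneg i)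
    (hp.hasSum_one i).summable, (hp.hasSum_one i).tsum_eq]
  simp

theorem tsum_weight_ne_top (hN : ∀ v, N v = 0 → v = 0) (hR : 0 < R) (hα0 : 0 ≤ α) (hα1 : α < 1)
    (j : Site d) : ∑' k, weight N R α j k ≠ ∞ := by
  have h := (Equiv.subRight j).tsum_eq fun k => ENNReal.ofReal (α ^ (siteNorm N k / R))
  exact (h.trans_ne (summable_rpow_siteNorm hN hR hα0 hα1).tsum_ofReal_ne_top)

theorem mem_growthClass_iff (hα0 : 0 ≤ α) {x : Config d} :
    x ∈ growthClass N R α ↔ ∑' k, weight N R α 0 k * ‖x k‖ₑ ≠ ∞ := by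
  have h (k : Site d) : weight N R α 0 k * ‖x k‖ₑ =
      ENNReal.ofReal (|x k| * α ^ (siteNorm N k / R)) := by
    rw [weight, sub_zero, Real.enorm_eq_ofReal_abs, mul_comm, ← ENNReal.ofReal_mul (abs_nonneg _)]
  have h0 (k : Site d) : 0 ≤ |x k| * α ^ (siteNorm N k / R) :=
    mul_nonneg (abs_nonneg _) (Real.rpow_nonneg hα0 _)
  simp_rw [h]
  refine ⟨fun hx => Summable.tsum_ofReal_ne_top hx, fun hx => ?_⟩
  have := ENNReal.summable_toReal hx
  simp_rw [ENNReal.toReal_ofReal (h0 _)] at this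
  exact this

theorem measurableSet_growthClass (hα0 : 0 ≤ α) : MeasurableSet (growthClass N R α) := by
  have : growthClass N R α = {x | ∑' k, weight N R α 0 k * ‖x k‖ₑ ≠ ∞} :=
    Set.ext fun x => mem_growthClass_iff hα0
  rw [this]
  have hm : Measurable fun x : Config d => ∑' k, weight N R α 0 k * ‖x k‖ₑ := by fun_prop
  exact hm (measurableSet_singleton ∞).compl

/-- The growth class does not depend on the choice of the origin. -/
theorem tsum_weight_mul_enorm_ne_top (hN : ∀ v, N v = 0 → v = 0) (hR : 0 < R) (hα0 : 0 ≤ α)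
    (hα1 : α < 1) {x : Config d} (hx : x ∈ growthClass N R α) (j : Site d) :
    ∑' k, weight N R α j k * ‖x k‖ₑ ≠ ∞ := by
  rcases hα0.eq_or_lt with rfl | hα
  · rw [tsum_eq_single j fun k hk => ?_]
    · simp [weight_self]
    · rw [weight, Real.zero_rpow (div_pos (siteNorm_pos hN (sub_ne_zero.2 hk)) hR).ne']
      simp
  · have h (k : Site d) : weight N R α j k ≤
        ENNReal.ofReal (α ^ (-(siteNorm N j / R))) * weight N R α 0 k := by
      rw [weight, weight, ← ENNReal.ofReal_mul (Real.rpow_nonneg hα0 _), ← Real.rpow_add hα,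
        sub_zero]
      refine ENNReal.ofReal_le_ofReal (Real.rpow_le_rpow_of_exponent_ge hα hα1.le ?_)
      have h2 := siteNorm_add_le (N := N) (k - j) j
      rw [sub_add_cancel] at h2
      rw [neg_add_eq_sub, ← sub_div]
      exact div_le_div_of_nonneg_right (by linarith) hR.le
    refine ne_top_of_le_ne_top (ENNReal.mul_ne_top
      (ENNReal.ofReal_ne_top (r := α ^ (-(siteNorm N j / R)))) ((mem_growthClass_iff hα0).1 hx)) ((ENNReal.tsum_le_tsum fun k =>
        mul_le_mul_left (h k) _).trans_eq ?_)
    simp_rw [mul_assoc]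
    rw [ENNReal.tsum_mul_left]

theorem weightedSum_weight_ne_top (hN : ∀ v, N v = 0 → v = 0) (hR : 0 < R) (hα0 : 0 ≤ α)
    (hα1 : α < 1) (hD : D ∈ growthClass N R α) {x : Config d} (hx : x ∈ growthClass N R α)
    (j : Site d) : weightedSum α D (weight N R α j) x ≠ ∞ := by
  refine ENNReal.add_ne_top.2 ⟨tsum_weight_mul_enorm_ne_top hN hR hα0 hα1 hx j, ?_⟩
  simp_rw [mul_add, mul_left_comm (weight N R α j _) (ENNReal.ofReal (1 - α))]
  rw [ENNReal.tsum_add, ENNReal.tsum_mul_left, ENNReal.tsum_mul_right]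
  exact ENNReal.add_ne_top.2
    ⟨ENNReal.mul_ne_top ENNReal.ofReal_ne_top (tsum_weight_mul_enorm_ne_top hN hR hα0 hα1 hD j),
      ENNReal.mul_ne_top (tsum_weight_ne_top hN hR hα0 hα1 j) gaussianMoment_ne_top⟩

theorem enorm_le_weightedSum (j : Site d) (y : Config d) :
    ‖y j‖ₑ ≤ weightedSum α D (weight N R α j) y := by
  refine le_trans ?_ (le_self_add)
  refine le_trans (le_of_eq ?_) (ENNReal.le_tsum j)
  rw [weight_self, one_mul]

theorem mem_growthClass_of_weightedSum_ne_top (hα0 : 0 ≤ α) {y : Config d}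
    (hy : weightedSum α D (weight N R α 0) y ≠ ∞) : y ∈ growthClass N R α :=
  (mem_growthClass_iff hα0).2 (ENNReal.add_ne_top.1 hy).1

end Harness

/-! ### The harness process -/

namespace Harness

open scoped BoundedContinuousFunction ENNReal

variable {d : ℕ} {N : Seminorm ℝ (Fin d → ℝ)} {R α : ℝ} {p : Site d → Site d → ℝ} {D : Config d}

/-- A transition function on the growth class whose derivative
at time zero is the generator. -/
theorem exists_transitionFunction_generator (hN : ∀ v, N v = 0 → v = 0) (hR : 0 < R)
    (hα0 : 0 ≤ α) (hα1 : α < 1) (hp : IsHarnessMatrix N R p) (hD : D ∈ growthClass N R α) :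
    ∃ P : ℝ≥0 → Kernel (growthClass N R α) (growthClass N R α), IsTransitionFunction P ∧
      ∀ f : Config d → ℝ, IsLocalTest f → ∀ x : growthClass N R α,
        Tendsto (fun u : ℝ≥0 => (u : ℝ)⁻¹ * ((∫ y, f y ∂(P u x)) - f x)) (𝓝[>] 0)
          (𝓝 (generator p α D f x)) := by
  obtain ⟨nb, m, hm, hcard, hnb⟩ := hp.exists_neighbours hN
  have hK := isLocalUpdate_heatBathOperator (α := α) (D := D) hm hcard hnb
  have hmk := isMarkovKernel_heatBathKernel (α := α) (D := D) hnb
  have hW (j : Site d) := isLyapunov_weightedSum (D := D) hp hα0 hα1 hnb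
    (mul_tsum_weight_le (N := N) hp hR hα0 hα1 j)
  obtain ⟨P, hP, hPint⟩ := exists_transitionFunction hK (measurableSet_growthClass hα0)
    fun (t : ℝ≥0) (x : growthClass N R α) => by
      have hx := weightedSum_weight_ne_top hN hR hα0 hα1 hD x.2
      obtain ⟨Q, hQ, hint, hae⟩ := exists_limitLaw (κ := heatBathKernel p α D) (x := x) hK
        (heatBathOperator_apply_eq_integral hnb) t.coe_nonneg
        fun j => ⟨_, hW j, enorm_le_weightedSum j, hx j⟩
      refine ⟨Q, hQ, hint, ?_⟩
      filter_upwards [hae _ (hW 0)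
        (lowerSemicontinuous_weightedSum fun _ => ENNReal.ofReal_ne_top) (hx 0)] with y hy
      exact mem_growthClass_of_weightedSum_ne_top hα0 hy
  refine ⟨P, hP, fun f hf x => ?_⟩
  obtain ⟨C, hC⟩ := hf.bounded
  obtain ⟨I, hI⟩ := hf.finitely_many
  let F : Config d →ᵇ ℝ := BoundedContinuousFunction.ofNormedAddCommGroup f hf.continuous C hC
  have hF : F ∈ dependingOn I := hI
  have h1 := hK.tendsto_limitSemigroup_sub_div hF x
  rw [← generator_eq_finiteGenerator hnb hF] at h1
  simp_rw [← hPint _ F (mem_localClosure hF)] at h1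
  exact h1

/-- The right derivative of the conditional expectation of a Markov process is given by the right
derivative of its transition function. -/
theorem ae_tendsto_condExp_sub {E Ω : Type*} [MeasurableSpace E] [MeasurableSpace Ω]
    {μ : Measure Ω} [IsProbabilityMeasure μ] {η : ℝ≥0 → Ω → E} (hη : ∀ t, Measurable (η t))
    {P : ℝ≥0 → Kernel E E} {f g : E → ℝ} (hf : Measurable f) {C : ℝ} (hC : ∀ x, |f x| ≤ C)
    {t : ℝ≥0}
    (h : ∀ u, μ[fun ω => f (η (t + u) ω) | past η t] =ᵐ[μ] fun ω => ∫ y, f y ∂(P u (η t ω)))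
    (hg : ∀ x, Tendsto (fun u : ℝ≥0 => (u : ℝ)⁻¹ * ((∫ y, f y ∂(P u x)) - f x)) (𝓝[>] 0)
      (𝓝 (g x)))
    {u : ℕ → ℝ≥0} (hu : Tendsto u atTop (𝓝[>] 0)) :
    ∀ᵐ ω ∂μ, Tendsto (fun n => (u n : ℝ)⁻¹ *
      (μ[fun ω' => f (η (t + u n) ω') - f (η t ω') | past η t]) ω) atTop (𝓝 (g (η t ω))) := by
  have hle : past η t ≤ ‹MeasurableSpace Ω› := iSup_le fun r => (hη r).comap_le
  have hηt : Measurable[past η t] (η t) := Measurable.of_comap_le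
    (le_iSup (fun s : Set.Iic t => MeasurableSpace.comap (η s) inferInstance)
      ⟨t, Set.mem_Iic.2 le_rfl⟩)
  have hint (s : ℝ≥0) : Integrable (fun ω => f (η s ω)) μ :=
    Integrable.of_bound (hf.comp (hη s)).aestronglyMeasurable C (ae_of_all _ fun ω => hC _)
  have hpast : μ[fun ω => f (η t ω) | past η t] = fun ω => f (η t ω) :=
    condExp_of_stronglyMeasurable hle (hf.comp hηt).stronglyMeasurable (hint t)
  have h1 (n : ℕ) : ∀ᵐ ω ∂μ,
      (μ[fun ω' => f (η (t + u n) ω') - f (η t ω') | past η t]) ω =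
        (∫ y, f y ∂(P (u n) (η t ω))) - f (η t ω) := by
    filter_upwards [condExp_sub (hint (t + u n)) (hint t) (past η t), h (u n)] with ω h2 h3
    rw [hpast] at h2
    exact h2.trans (by rw [Pi.sub_apply, h3])
  filter_upwards [ae_all_iff.2 h1] with ω hω
  simp_rw [hω]
  exact (hg (η t ω)).comp hu

end Harness

theorem theorem1 (d : ℕ) (N : Seminorm ℝ (Fin d → ℝ)) (hN : ∀ v, N v = 0 → v = 0)
    (R : ℝ) (hR : 0 < R) (α : ℝ) (hα0 : 0 ≤ α) (hα1 : α < 1)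
    (p : Harness.Site d → Harness.Site d → ℝ) (hp : Harness.IsHarnessMatrix N R p)
    (D : Harness.Config d) (hD : D ∈ Harness.growthClass N R α) :
    ∃ P : ℝ≥0 → Kernel (Harness.growthClass N R α) (Harness.growthClass N R α),
      Harness.IsTransitionFunction P ∧
      (∀ f : Harness.Config d → ℝ, Harness.IsLocalTest f → ∀ x : Harness.growthClass N R α,
        Tendsto (fun u : ℝ≥0 => (u : ℝ)⁻¹ * ((∫ y, f y ∂(P u x)) - f x)) (𝓝[>] 0)
          (𝓝 (Harness.generator p α D f x))) ∧
      ∀ ν : Measure (Harness.growthClass N R α), IsProbabilityMeasure ν →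
        ∃ (Ω : Type) (_ : MeasurableSpace Ω) (μ : Measure Ω) (_ : IsProbabilityMeasure μ)
          (η : ℝ≥0 → Ω → Harness.growthClass N R α),
          Harness.IsMarkovProcess P ν μ η ∧
          ∀ f : Harness.Config d → ℝ, Harness.IsLocalTest f → ∀ t : ℝ≥0,
            ∀ u : ℕ → ℝ≥0, Tendsto u atTop (𝓝[>] 0) →
              ∀ᵐ ω ∂μ, Tendsto
                (fun n => (u n : ℝ)⁻¹ *
                  (μ[fun ω' => f (η (t + u n) ω') - f (η t ω') | Harness.past η t]) ω)
                atTop (𝓝 (Harness.generator p α D f (η t ω))) := by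
  obtain ⟨P, hP, hgen⟩ :=
    Harness.exists_transitionFunction_generator hN hR hα0 hα1 hp hD
  refine ⟨P, hP, hgen, fun ν hν => ?_⟩
  have : StandardBorelSpace (Harness.growthClass N R α) :=
    (Harness.measurableSet_growthClass hα0).standardBorel
  obtain ⟨μ, hμ, hinit, hmarkov⟩ := exists_markovPathLaw hP ν
  have hη (t : ℝ≥0) : Measurable fun ω : ℝ≥0 → Harness.growthClass N R α => ω t :=
    measurable_pi_apply t
  refine ⟨_, _, μ, hμ, fun t ω => ω t, ⟨hη, hinit, fun t u A hA => ?_⟩,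
    fun f hf t u hu => ?_⟩
  · have h := condExp_markov hη hP.markov (hmarkov t u)
      (f := A.indicator 1) (measurable_one.indicator hA) (C := 1)
      fun x => by by_cases hx : x ∈ A <;> simp [hx]
    simp_rw [integral_indicator_one hA] at h
    exact h
  · obtain ⟨C, hC⟩ := hf.bounded
    have hfm : Measurable fun x : Harness.growthClass N R α => f x :=
      hf.continuous.measurable.comp measurable_subtype_coe
    exact Harness.ae_tendsto_condExp_sub hη hfm (fun x => hC x)
      (fun u => condExp_markov hη hP.markov (hmarkov t u) hfm fun x => hC x)
      (hgen f hf) hu
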